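/- Let $d\ge 1$ and let $m,\sigma:\mathbb R\times\mathbb R^d\to\mathbb R$ satisfy $m(u,y)=m(0,y)$, $\sigma(u,y)=\sigma(0,y)$ for $u\le 0$ and $m(u,y)=m(1,y)$, $\sigma(u,y)=\sigma(1,y)$ for $u\ge 1$. Let $(\varepsilon_t)_{t\in\mathbb Z}$ be real random variables. Assume, with common constants $K_1,\delta$: (M1) $|m(u,y)|\le\overline m<\infty$ for all $u,y$; (Σ1) $0<\underline\sigma\le\sigma(u,y)\le\overline\sigma<\infty$ for all $u,y$. (M2), (Σ2) There is $L<\infty$ with $|g(u,y)-g(u',y)|\le L|u-u'|$ for all $u,u',y$, for $g=m$ and for $g=\sigma$. (M3), (Σ3) For $g=m$ and $g=\sigma$, $g(u,\cdot)$ is continuously differentiable for every $u$, and $|\partial_{y_j}g(u,y)|\le\delta<1$ for all $j$, all $u\in\mathbb R$ and all $y$ with $\|y\|_\infty>K_1$. Here $\delta$ is so small that $$\delta<\Big[(1+E|\varepsilon_0|)^{\frac{d}{1-\kappa}}\,(\Delta+1)^{\frac{\kappa d}{1-\kappa}}\,C_d\Big]^{-1},\qquad C_d=\sum_{l=0}^{d-1}\sum_{k=0}^{l}\binom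 lk,$$ for some finite $\Delta$ with $|\partial_{y_j}m(u,y)|\le\Delta$ and $|\partial_{y_j}\sigma(u,y)|\le\Delta$ for all $j,u,y$, and some $\kappa<1$ with $\kappa>P\big(\min_{1\le l\le d}|\varepsilon_{-l}|\le K_2\big)$, where $K_2=(K_1+\overline m)/\underline\sigma$. (E1) The $\varepsilon_t$ are i.i.d. with $E[\varepsilon_t]=0$ and $E|\varepsilon_t|^{1+\eta}<\infty$ for some $\eta>0$, and they have an everywhere positive and continuous density. Let $\{X_{t,T}:t\in\mathbb Z\}_{T\ge1}$ be a tvNAR process, that is, almost surely $$X_{t,T}=m\big(\tfrac tT,X_{t-1,T},\dots,X_{t-d,T}\big)+\sigma\big(\tfrac tT,X_{t-1,T},\dots,X_{t-d,T}\big)\varepsilon_t\qquad(t\in\mathbb Z,\ T\ge1).$$ (a) Let $\{X_t(u):t\in\mathbb Z\}$, $u\in\mathbb R$, be processes with, almost surely, $X_t(u)=m(u,X_{t-1}(u),\dots,X_{t-d}(u))+\sigma(u,X_{t-1}(u),\dots,X_{t-d}(u))\varepsilon_t$ for all $t\in\mathbb Z$. Then there are $\rho>0$, $C<\infty$ and positive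 random variables $U_{t,T}(u)$ such that, for all $u\in\mathbb R$, $t\in\mathbb Z$ and $T\ge1$, $$|X_{t,T}-X_t(u)|\le\Big(\Big|\frac tT-u\Big|+\frac1T\Big)U_{t,T}(u)\quad\text{a.s.},\qquad E[U_{t,T}(u)^\rho]<C .$$ (b) The tvNAR process is locally stationary: for each $u\in[0,1]$ there is a strictly stationary process $\{Y_t(u):t\in\mathbb Z\}$ whose variables have a Lebesgue density such that $|X_{t,T}-Y_t(u)|\le(|\frac tT-u|+\frac1T)U_{t,T}(u)$ a.s. for $1\le t\le T$, with positive random variables $U_{t,T}(u)$ satisfying $E[U_{t,T}(u)^\rho]<C$ for some $\rho>0$ and $C<\infty$ independent of $u$, $t$ and $T$. -/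

import Mathlib

open MeasureTheory ProbabilityTheory

noncomputable section

namespace TvNAR

variable {Ω : Type*} [MeasurableSpace Ω] {d : ℕ}

/-- The vector of the `d` values of `Z` preceding time `t`: its `j`-th coordinate
(`j = 1, …, d`) is `Z_{t-j}`. -/
def lags (d : ℕ) (Z : ℤ → Ω → ℝ) (t : ℤ) (ω : Ω) : Fin d → ℝ :=
  fun j => Z (t - ((j : ℕ) + 1 : ℤ)) ω

/-- The partial derivative `∂_j g (u, y)` with respect to the `j`-th coordinate of `y`. -/
def partialDeriv (g : ℝ → (Fin d → ℝ) → ℝ) (j : Fin d) (u : ℝ) (y : Fin d → ℝ) : ℝ :=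
  fderiv ℝ (g u) y (Pi.single j 1)

/-- The convention `g(u, y) = g(0, y)` for `u ≤ 0` and `g(u, y) = g(1, y)` for `u ≥ 1`. -/
def ConstOutsideUnit (g : ℝ → (Fin d → ℝ) → ℝ) : Prop :=
  (∀ u y, u ≤ 0 → g u y = g 0 y) ∧ (∀ u y, 1 ≤ u → g u y = g 1 y)

/-- Lipschitz continuity with respect to rescaled time, uniformly in `y`. -/
def LipschitzInTime (g : ℝ → (Fin d → ℝ) → ℝ) : Prop :=
  ∃ L : ℝ, ∀ u u' y, |g u y - g u' y| ≤ L * |u - u'|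

/-- `g` is continuously differentiable with respect to `y`, and its partial
derivatives are bounded by `δ < 1` at all `y` with `‖y‖_∞ > K₁`
(the norm of `Fin d → ℝ` is the maximum norm). -/
def SmallSlopes (g : ℝ → (Fin d → ℝ) → ℝ) (K₁ δ : ℝ) : Prop :=
  (∀ u, ContDiff ℝ 1 (g u)) ∧ δ < 1 ∧
    ∀ (j : Fin d) (u : ℝ) (y : Fin d → ℝ), K₁ < ‖y‖ → |partialDeriv g j u y| ≤ δ

/-- The conditions on `m`, with constants `mUp`, `K₁`, `δ`. -/
structure CondM (m : ℝ → (Fin d → ℝ) → ℝ) (mUp K₁ δ : ℝ) : Prop where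
  bounded : ∀ u y, |m u y| ≤ mUp
  lipschitz : LipschitzInTime m
  slopes : SmallSlopes m K₁ δ

/-- The conditions on `σ`, with constants `σLow`, `σUp`, `K₁`, `δ`. -/
structure CondSigma (σ : ℝ → (Fin d → ℝ) → ℝ) (σLow σUp K₁ δ : ℝ) : Prop where
  low_pos : 0 < σLow
  bounded : ∀ u y, σLow ≤ σ u y ∧ σ u y ≤ σUp
  lipschitz : LipschitzInTime σ
  slopes : SmallSlopes σ K₁ δ

/-- The errors are i.i.d. with mean zero, a finite absolute moment of order `1 + η` for
some `η > 0`, and an everywhere positive and continuous density. -/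
structure CondE (μ : Measure Ω) (ε : ℤ → Ω → ℝ) : Prop where
  measurable : ∀ t, Measurable (ε t)
  indep : iIndepFun ε μ
  identDistrib : ∀ t, IdentDistrib (ε t) (ε 0) μ μ
  mean_zero : ∫ ω, ε 0 ω ∂μ = 0
  moment : ∃ η : ℝ, 0 < η ∧ Integrable (fun ω => |ε 0 ω| ^ (1 + η)) μ
  density : ∃ f : ℝ → ℝ, Continuous f ∧ (∀ z, 0 < f z) ∧
    μ.map (ε 0) = volume.withDensity (fun z => ENNReal.ofReal (f z))

/-- The constant `C_d = ∑_{l=0}^{d-1} ∑_{k=0}^{l} binom(l, k)`. -/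
def slopeConst (d : ℕ) : ℕ := ∑ l ∈ Finset.range d, ∑ k ∈ Finset.range (l + 1), l.choose k

/-- The bound on `δ` which is part of the conditions on the slopes:
`δ < [(1 + E|ε₀|)^{d/(1-κ)} (Δ + 1)^{κd/(1-κ)} C_d]⁻¹`, where `Δ` bounds all partial
derivatives of `m` and `σ` and where `P(min_{l=1,…,d} |ε_{-l}| ≤ K₂) < κ < 1`
with `K₂ = (K₁ + mUp) / σLow`. -/
def DeltaBound (μ : Measure Ω) (ε : ℤ → Ω → ℝ) (m σ : ℝ → (Fin d → ℝ) → ℝ)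
    (mUp σLow K₁ δ : ℝ) : Prop :=
  ∃ Δ κ : ℝ,
    (∀ j u y, |partialDeriv m j u y| ≤ Δ) ∧
    (∀ j u y, |partialDeriv σ j u y| ≤ Δ) ∧
    μ.real {ω | ∃ l ∈ Finset.Icc 1 d, |ε (-(l : ℤ)) ω| ≤ (K₁ + mUp) / σLow} < κ ∧
    κ < 1 ∧
    δ < ((1 + ∫ ω, |ε 0 ω| ∂μ) ^ ((d : ℝ) / (1 - κ)) *
          (Δ + 1) ^ (κ * (d : ℝ) / (1 - κ)) * (slopeConst d : ℝ))⁻¹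

/-- The array `X T t = X_{t,T}` (`t ∈ ℤ`, `T ≥ 1`) is a time-varying nonlinear
autoregressive process. -/
def IsTvNAR (μ : Measure Ω) (m σ : ℝ → (Fin d → ℝ) → ℝ) (ε : ℤ → Ω → ℝ)
    (X : ℕ → ℤ → Ω → ℝ) : Prop :=
  ∀ T : ℕ, 1 ≤ T → ∀ t : ℤ, Measurable (X T t) ∧
    ∀ᵐ ω ∂μ, X T t ω = m ((t : ℝ) / T) (lags d (X T) t ω) +
      σ ((t : ℝ) / T) (lags d (X T) t ω) * ε t ω

/-- `Y t = X_t(u)` (`t ∈ ℤ`) solves the autoregression whose rescaled time is frozen at `u`. -/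
def IsFrozenNAR (μ : Measure Ω) (m σ : ℝ → (Fin d → ℝ) → ℝ) (ε : ℤ → Ω → ℝ)
    (u : ℝ) (Y : ℤ → Ω → ℝ) : Prop :=
  ∀ t : ℤ, Measurable (Y t) ∧
    ∀ᵐ ω ∂μ, Y t ω = m u (lags d Y t ω) + σ u (lags d Y t ω) * ε t ω

/-- `V` is a positive random variable with `E[V^ρ] < C`. -/
def MomentBound (μ : Measure Ω) (ρ C : ℝ) (V : Ω → ℝ) : Prop :=
  Measurable V ∧ (∀ ω, 0 < V ω) ∧ Integrable (fun ω => V ω ^ ρ) μ ∧ ∫ ω, V ω ^ ρ ∂μ < C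

/-- Strict stationarity: the finite-dimensional distributions are invariant under time shifts. -/
def IsStrictlyStationary (μ : Measure Ω) (Y : ℤ → Ω → ℝ) : Prop :=
  (∀ t, Measurable (Y t)) ∧ ∀ (n : ℕ) (s : Fin n → ℤ) (h : ℤ),
    μ.map (fun ω i => Y (s i + h) ω) = μ.map (fun ω i => Y (s i) ω)

/-- Local stationarity of a real-valued array `X T t = X_{t,T}`, `1 ≤ t ≤ T`: for each
`u ∈ [0,1]` there is a strictly stationary process `Y u` with a density such that
`|X_{t,T} - Y_t(u)| ≤ (|t/T - u| + 1/T) U_{t,T}(u)` a.s., where the positive variables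
`U_{t,T}(u)` have `ρ`-th moments below `C`, with `ρ > 0` and `C` independent of `u, t, T`. -/
def IsLocallyStationary (μ : Measure Ω) (X : ℕ → ℤ → Ω → ℝ) : Prop :=
  ∃ (Y : ℝ → ℤ → Ω → ℝ) (U : ℝ → ℕ → ℤ → Ω → ℝ) (ρ C : ℝ), 0 < ρ ∧
    ∀ u ∈ Set.Icc (0 : ℝ) 1,
      IsStrictlyStationary μ (Y u) ∧ (∀ t, HasPDF (Y u t) μ volume) ∧
      ∀ (T : ℕ) (t : ℤ), 1 ≤ t → t ≤ T →
        MomentBound μ ρ C (U u T t) ∧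
        ∀ᵐ ω ∂μ, |X T t ω - Y u t ω| ≤ (|(t : ℝ) / T - u| + 1 / T) * U u T t ω

end TvNAR

end

noncomputable section

namespace TvNAR

section

/-! ### Deterministic contraction -/

/-! The distance between two solutions driven by the same noise contracts on average. Let `D i` be
their distance `i` steps before the present. By the mean value theorem, `D i` is at most `1 + |e i|`
times a slope bound times the sum of the `d` preceding distances, plus an error from the difference
in rescaled time. The slope bound is always `Δ`. It drops to `δ` as soon as one lagged noise
variable exceeds `K₂ = (K₁ + mUp) / σLow` in modulus: that variable pushes the corresponding
coordinates of both lag vectors beyond `K₁` with the same sign, so the whole segment between the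
vectors avoids the ball where slopes may be large.

Time is cut into blocks of length `d`. The noise just before a block is among the lags of every time
in the block, so this one variable decides whether the block contributes `(1 + Δ) ^ d` or `δ * C_d`,
besides its noise product (`block_le`, `head_le_sum_blockProd`). The total distance is then bounded
by the series `∑ (k + 1) * blockProd k`, where the weight `k + 1` comes from the rescaled time
distance growing linearly into the past.

With `p = P(|ε₀| ≤ K₂)` and `M = (1 + E|ε₀|) ^ d`, the bound on `δ` says that `p log ((1 + Δ) ^ d M)
+ (1 - p) log (δ C_d M)` is negative. Hence some small moment of the block products decays
geometrically (`lintegral_blockProd_rpow_le`), and the series has a finite moment of order `ρ ≤ 1`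
(`exists_blockSeries_moment`). It is therefore a.s. finite, its terms vanish in the limit, and the
remote past is forgotten. This gives (a). The same comparison shows that frozen recursions started
ever further back converge. Their limit is a measurable functional of the past i.i.d. noise, hence
stationary, and it is affine in the present noise with nonzero slope, hence has a density. This
gives (b). -/

theorem slopeConst_eq_sum (d : ℕ) : (slopeConst d : ℝ) = ∑ q ∈ Finset.range d, (2 : ℝ) ^ q := by
  simp [slopeConst, Nat.sum_range_choose]

theorem prod_one_add_abs_mono (e : ℕ → ℝ) :
    Monotone fun n => ∏ i ∈ Finset.range n, (1 + |e i|) := by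
  refine monotone_nat_of_le_succ fun n => ?_
  rw [Finset.prod_range_succ]
  exact le_mul_of_one_le_right (by positivity) (by linarith [abs_nonneg (e n)])

theorem one_le_prod_one_add_abs (e : ℕ → ℝ) (n : ℕ) :
    1 ≤ ∏ i ∈ Finset.range n, (1 + |e i|) := by
  simpa using prod_one_add_abs_mono e (Nat.zero_le n)

theorem one_add_abs_le_prod (e : ℕ → ℝ) {j n : ℕ} (h : j < n) :
    1 + |e j| ≤ ∏ i ∈ Finset.range n, (1 + |e i|) := by
  refine le_trans ?_ (prod_one_add_abs_mono e (Nat.succ_le_of_lt h))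
  simp only [Nat.succ_eq_add_one, Finset.prod_range_succ]
  exact le_mul_of_one_le_left (by positivity) (one_le_prod_one_add_abs e j)

/-- Growth over `q ≤ d` steps of the sliding sums of a sequence that satisfies a linear
recursive inequality of order `d`. -/
theorem slidingSum_le {d : ℕ} {D e : ℕ → ℝ} {a N : ℝ} (hD : ∀ i, 0 ≤ D i) (ha : 0 ≤ a)
    (hN : 0 ≤ N)
    (h : ∀ q < d, D (q + d) ≤ (1 + |e q|) * (a * ∑ j ∈ Finset.range d, D (q + j) + N)) :
    ∀ q ≤ d, ∑ j ∈ Finset.range d, D (q + j) ≤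
      (1 + a) ^ q * (∏ i ∈ Finset.range q, (1 + |e i|)) *
        (∑ j ∈ Finset.range d, D j + q * N) := by
  intro q
  induction q with
  | zero => intro _; simp
  | succ q ih =>
    intro hq
    have ih := ih (by omega)
    have hs := h q (by omega)
    have h1 : ∑ j ∈ Finset.range d, D (q + 1 + j) + D q
        = ∑ j ∈ Finset.range d, D (q + j) + D (q + d) := by
      rw [← Finset.sum_range_succ (fun j => D (q + j)), Finset.sum_range_succ']
      simp only [add_zero, add_left_inj]
      refine Finset.sum_congr rfl fun j _ => by congr 1; ring
    rw [Finset.prod_range_succ]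
    set S := ∑ j ∈ Finset.range d, D (q + j)
    set S₀ := ∑ j ∈ Finset.range d, D j
    set P := ∏ i ∈ Finset.range q, (1 + |e i|)
    have hS : 0 ≤ S := Finset.sum_nonneg fun i _ => hD _
    have hP : 1 ≤ (1 + a) ^ (q + 1) * P := by
      refine one_le_mul_of_one_le_of_one_le (one_le_pow₀ (by linarith)) ?_
      exact one_le_prod_one_add_abs e q
    have he : 0 ≤ |e q| := abs_nonneg _
    calc ∑ j ∈ Finset.range d, D (q + 1 + j) ≤ S + D (q + d) := by linarith [hD q]
      _ ≤ (1 + |e q|) * ((1 + a) * S + N) := by nlinarith [mul_nonneg he hS]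
      _ ≤ (1 + |e q|) * ((1 + a) * ((1 + a) ^ q * P * (S₀ + q * N))
            + (1 + a) ^ (q + 1) * P * N) := by
          gcongr
          nlinarith
      _ = _ := by push_cast; ring

/-- One block of `d` steps: the general bound. -/
theorem block_le_of_bounded {d : ℕ} {D e : ℕ → ℝ} {a N : ℝ} (hD : ∀ i, 0 ≤ D i) (ha : 0 ≤ a)
    (hN : 0 ≤ N)
    (h : ∀ q < d, D (q + d) ≤ (1 + |e q|) * (a * ∑ j ∈ Finset.range d, D (q + j) + N)) :
    ∑ j ∈ Finset.range d, D (d + j) ≤ (∏ i ∈ Finset.range d, (1 + |e i|)) *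
      ((1 + a) ^ d * ∑ j ∈ Finset.range d, D j + (((1 + a) ^ d + 1) * d) * N) := by
  have h1 := slidingSum_le hD ha hN h d le_rfl
  have hP : 0 ≤ ∏ i ∈ Finset.range d, (1 + |e i|) := by positivity
  refine h1.trans ?_
  have : 0 ≤ (∏ i ∈ Finset.range d, (1 + |e i|)) * (d * N) := by positivity
  nlinarith

/-- One block of `d` steps with small slopes. -/
theorem block_le_of_small {d : ℕ} {D e : ℕ → ℝ} {a N : ℝ} (hD : ∀ i, 0 ≤ D i) (ha : 0 ≤ a)
    (ha1 : a ≤ 1) (hN : 0 ≤ N)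
    (h : ∀ q < d, D (q + d) ≤ (1 + |e q|) * (a * ∑ j ∈ Finset.range d, D (q + j) + N)) :
    ∑ j ∈ Finset.range d, D (d + j) ≤ (∏ i ∈ Finset.range d, (1 + |e i|)) *
      (a * slopeConst d * ∑ j ∈ Finset.range d, D j + ((a * slopeConst d + 1) * d) * N) := by
  have h1 := slidingSum_le hD ha hN h
  have hS0 : 0 ≤ ∑ j ∈ Finset.range d, D j := Finset.sum_nonneg fun i _ => hD _
  -- Each of the `d` new terms carries its own factor `a`. The window sum before the `q`-th of them
  -- has grown by at most `(1 + a) ^ q ≤ 2 ^ q` times the noise product, and the powers of two add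
  -- up to `slopeConst d`.
  calc ∑ q ∈ Finset.range d, D (d + q)
      ≤ ∑ q ∈ Finset.range d, (∏ i ∈ Finset.range d, (1 + |e i|)) *
        (a * (2 ^ q * (∑ j ∈ Finset.range d, D j + d * N)) + N) := by
        refine Finset.sum_le_sum fun q hq => ?_
        have hq := Finset.mem_range.1 hq
        rw [add_comm]
        have hP1 : ∏ i ∈ Finset.range (q + 1), (1 + |e i|) ≤ ∏ i ∈ Finset.range d, (1 + |e i|) :=
          prod_one_add_abs_mono e hq
        rw [Finset.prod_range_succ] at hP1
        have hP : 1 ≤ ∏ i ∈ Finset.range q, (1 + |e i|) :=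
          one_le_prod_one_add_abs e q
        have he := abs_nonneg (e q)
        have hqd : (q : ℝ) ≤ d := by exact_mod_cast hq.le
        calc D (q + d) ≤ (1 + |e q|) * (a * ∑ j ∈ Finset.range d, D (q + j) + N) := h q hq
          _ ≤ (1 + |e q|) * (a * ((2 ^ q * (∏ i ∈ Finset.range q, (1 + |e i|)) *
              (∑ j ∈ Finset.range d, D j + d * N)))
                + (∏ i ∈ Finset.range q, (1 + |e i|)) * N) := by
              gcongr
              · refine (h1 q hq.le).trans ?_
                gcongr
                linarith
              · nlinarith
          _ = ((∏ i ∈ Finset.range q, (1 + |e i|)) * (1 + |e q|)) *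
              (a * (2 ^ q * (∑ j ∈ Finset.range d, D j + d * N)) + N) := by ring
          _ ≤ _ := by gcongr
    _ = _ := by
        rw [← Finset.mul_sum, Finset.sum_add_distrib, ← Finset.mul_sum, ← Finset.sum_mul,
          ← slopeConst_eq_sum]
        simp only [Finset.sum_const, Finset.card_range, nsmul_eq_mul]
        ring

/-- The factor by which one block contributes, depending on whether the last noise variable
before the block is large. -/
def slopeFactor (a b K x : ℝ) : ℝ := if K < |x| then b else a

/-- The growth factor of `k + 1` blocks of length `d`. The noise is indexed backwards in time. -/
def blockProd (d : ℕ) (a b K : ℝ) (e : ℕ → ℝ) (k : ℕ) : ℝ :=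
  (∏ i ∈ Finset.range ((k + 1) * d), (1 + |e i|)) *
    ∏ j ∈ Finset.range k, slopeFactor a b K (e ((j + 1) * d))

theorem slopeFactor_pos {a b : ℝ} (ha : 0 < a) (hb : 0 < b) (K x : ℝ) :
    0 < slopeFactor a b K x := by
  unfold slopeFactor; split_ifs <;> assumption

theorem blockProd_nonneg {d : ℕ} {a b : ℝ} (ha : 0 < a) (hb : 0 < b) (K : ℝ) (e : ℕ → ℝ)
    (k : ℕ) : 0 ≤ blockProd d a b K e k :=
  mul_nonneg (by positivity) (Finset.prod_nonneg fun _ _ => (slopeFactor_pos ha hb _ _).le)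

/-- One block of `d` steps, with the noise indexed backwards in time. -/
theorem block_le {d : ℕ} {D e : ℕ → ℝ} {Δ δ K N : ℝ} (hD : ∀ i, 0 ≤ D i) (hΔ : 0 ≤ Δ)
    (hδ : 0 ≤ δ) (hδ1 : δ * slopeConst d ≤ 1) (hδ2 : δ ≤ 1) (hN : 0 ≤ N) (k : ℕ)
    (h : ∀ i, k * d ≤ i → i < (k + 1) * d →
      D i ≤ (1 + |e i|) * (Δ * ∑ j ∈ Finset.range d, D (i + 1 + j) + N))
    (h' : ∀ i, k * d ≤ i → i < (k + 1) * d → K < |e ((k + 1) * d)| →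
      D i ≤ (1 + |e i|) * (δ * ∑ j ∈ Finset.range d, D (i + 1 + j) + N)) :
    ∑ j ∈ Finset.range d, D (k * d + j) ≤ (∏ i ∈ Finset.range d, (1 + |e (k * d + i)|)) *
      (slopeFactor ((1 + Δ) ^ d) (δ * slopeConst d) K (e ((k + 1) * d)) *
        ∑ j ∈ Finset.range d, D ((k + 1) * d + j) + (((1 + Δ) ^ d + 1) * d) * N) := by
  -- Time reversal: `D'` runs forward from the oldest of the `2 * d` indices involved, so its first
  -- `d` terms are the initial window and its next `d` terms the block.
  set D' : ℕ → ℝ := fun q => D ((k + 2) * d - 1 - q) with hD'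
  set e' : ℕ → ℝ := fun q => e ((k + 1) * d - 1 - q) with he'
  have hD'0 : ∀ i, 0 ≤ D' i := fun i => hD _
  have hk2 : (k + 2) * d = k * d + d + d := by ring
  have hk1 : (k + 1) * d = k * d + d := by ring
  have key : ∀ c : ℝ, (∀ i, k * d ≤ i → i < (k + 1) * d →
      D i ≤ (1 + |e i|) * (c * ∑ j ∈ Finset.range d, D (i + 1 + j) + N)) →
      ∀ q < d, D' (q + d) ≤ (1 + |e' q|) * (c * ∑ j ∈ Finset.range d, D' (q + j) + N) := by
    intro c hc q hq
    have h1 := hc ((k + 1) * d - 1 - q) (by omega) (by omega)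
    have h2 : D' (q + d) = D ((k + 1) * d - 1 - q) := by
      simp only [hD']; congr 1; omega
    have h3 : ∑ j ∈ Finset.range d, D' (q + j)
        = ∑ j ∈ Finset.range d, D ((k + 1) * d - 1 - q + 1 + j) := by
      rw [← Finset.sum_range_reflect]
      refine Finset.sum_congr rfl fun j hj => ?_
      have := Finset.mem_range.1 hj
      simp only [hD']; congr 1; omega
    rw [h2, h3]; exact h1
  have e1 : ∑ j ∈ Finset.range d, D (k * d + j) = ∑ j ∈ Finset.range d, D' (d + j) := by
    rw [← Finset.sum_range_reflect]
    refine Finset.sum_congr rfl fun j hj => ?_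
    have := Finset.mem_range.1 hj
    simp only [hD']; congr 1; omega
  have e2 : ∑ j ∈ Finset.range d, D ((k + 1) * d + j) = ∑ j ∈ Finset.range d, D' j := by
    rw [← Finset.sum_range_reflect]
    refine Finset.sum_congr rfl fun j hj => ?_
    have := Finset.mem_range.1 hj
    simp only [hD']; congr 1; omega
  have e3 : ∏ i ∈ Finset.range d, (1 + |e (k * d + i)|) = ∏ i ∈ Finset.range d, (1 + |e' i|) := by
    rw [← Finset.prod_range_reflect]
    refine Finset.prod_congr rfl fun j hj => ?_
    have := Finset.mem_range.1 hj
    simp only [he']; congr 3; omega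
  rw [e1, e2, e3]
  unfold slopeFactor
  split_ifs with hK
  · refine (block_le_of_small hD'0 hδ hδ2 hN (key δ fun i h1 h2 => h' i h1 h2 hK)).trans ?_
    have : (1 : ℝ) ≤ (1 + Δ) ^ d := one_le_pow₀ (by linarith)
    gcongr
    linarith
  · exact block_le_of_bounded hD'0 hΔ hN (key Δ h)

/-- Iteration over `n` blocks. -/
theorem head_le_sum_blockProd {d : ℕ} (hd : 1 ≤ d) {D e : ℕ → ℝ} {Δ δ K c γ : ℝ}
    (hD : ∀ i, 0 ≤ D i) (hΔ : 0 ≤ Δ) (hδ : 0 < δ) (hδ1 : δ * slopeConst d ≤ 1) (hδ2 : δ ≤ 1)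
    (hc : 0 ≤ c) (n : ℕ)
    (h : ∀ i < n * d,
      D i ≤ (1 + |e i|) * (Δ * ∑ j ∈ Finset.range d, D (i + 1 + j) + c * (i + 1)))
    (h' : ∀ i < n * d, ∀ j < d, K < |e (i + 1 + j)| →
      D i ≤ (1 + |e i|) * (δ * ∑ j ∈ Finset.range d, D (i + 1 + j) + c * (i + 1)))
    (hγ : ∀ i, D i ≤ γ * (1 + |e i|)) :
    D 0 ≤ c * ((((1 + Δ) ^ d + 1) * d) * d) *
        ∑ k ∈ Finset.range n, (k + 1) * blockProd d ((1 + Δ) ^ d) (δ * slopeConst d) K e k +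
      (d * γ) * blockProd d ((1 + Δ) ^ d) (δ * slopeConst d) K e n := by
  have hγ0 : 0 ≤ γ := by
    have := (hD 0).trans (hγ 0)
    nlinarith [abs_nonneg (e 0)]
  have ha : 0 < (1 + Δ) ^ d := by positivity
  have hb : 0 < δ * slopeConst d := by
    refine mul_pos hδ ?_
    rw [slopeConst_eq_sum]
    exact Finset.sum_pos (fun _ _ => by positivity) ⟨0, Finset.mem_range.2 hd⟩
  set a := (1 + Δ) ^ d
  set b := δ * slopeConst d
  set w : ℕ → ℝ := fun k => ∑ j ∈ Finset.range d, D (k * d + j) with hw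
  have h0 : D 0 ≤ w 0 := by
    have := Finset.single_le_sum (f := fun j => D (0 * d + j)) (fun j _ => hD _)
      (Finset.mem_range.2 hd)
    simpa [hw] using this
  have step : ∀ k < n, w k ≤ (∏ i ∈ Finset.range d, (1 + |e (k * d + i)|)) *
      (slopeFactor a b K (e ((k + 1) * d)) * w (k + 1) + ((a + 1) * d) * (c * ((k + 1) * d))) := by
    intro k hk
    have hkn : (k + 1) * d ≤ n * d := Nat.mul_le_mul_right d hk
    -- Bounding the time error by its value at the far end of the block produces the weight `k + 1`
    -- of the series.
    have hcast : ∀ i : ℕ, i < (k + 1) * d → c * ((i : ℝ) + 1) ≤ c * ((k + 1) * d) := by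
      intro i hi
      have : ((i + 1 : ℕ) : ℝ) ≤ ((k + 1) * d : ℕ) := by exact_mod_cast hi
      push_cast at this
      gcongr
    refine block_le hD hΔ hδ.le hδ1 hδ2 (by positivity) k ?_ ?_
    · intro i hi1 hi2
      refine (h i (by omega)).trans ?_
      have := hcast i hi2
      gcongr
    · intro i hi1 hi2 hK
      have hi3 : (k + 1) * d = k * d + d := by ring
      -- This lag points from `i` to `(k + 1) * d`, the common lagged time of the whole block.
      refine (h' i (by omega) ((k + 1) * d - i - 1) (by omega) ?_).trans ?_
      · convert hK using 3; omega
      have := hcast i hi2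
      gcongr
  have main : ∀ n' ≤ n, w 0 ≤ c * (((a + 1) * d) * d) *
        ∑ k ∈ Finset.range n', (k + 1) * blockProd d a b K e k +
      (∏ i ∈ Finset.range (n' * d), (1 + |e i|)) *
        (∏ j ∈ Finset.range n', slopeFactor a b K (e ((j + 1) * d))) * w n' := by
    intro n'
    induction n' with
    | zero => intro _; simp
    | succ n' ih =>
      intro hn'
      refine (ih (by omega)).trans ?_
      have hs := step n' (by omega)
      have hp : 0 ≤ (∏ i ∈ Finset.range (n' * d), (1 + |e i|)) *
        (∏ j ∈ Finset.range n', slopeFactor a b K (e ((j + 1) * d))) :=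
        mul_nonneg (by positivity) (Finset.prod_nonneg fun _ _ => (slopeFactor_pos ha hb _ _).le)
      have := mul_le_mul_of_nonneg_left hs hp
      refine (add_le_add_right this _).trans (le_of_eq ?_)
      rw [Finset.sum_range_succ, blockProd, add_mul n' 1 d, one_mul, Finset.prod_range_add,
        Finset.prod_range_succ _ n']
      ring_nf
  refine h0.trans ((main n le_rfl).trans (add_le_add_right ?_ _))
  -- The a priori bound on the last window supplies the extra `d` noise factors by which `blockProd`
  -- exceeds `n` full blocks.
  have hwn : w n ≤ d * γ * ∏ i ∈ Finset.range d, (1 + |e (n * d + i)|) := by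
    calc w n ≤ ∑ j ∈ Finset.range d, γ * ∏ i ∈ Finset.range d, (1 + |e (n * d + i)|) := by
          refine Finset.sum_le_sum fun j hj => (hγ _).trans ?_
          gcongr
          exact one_add_abs_le_prod (fun i => e (n * d + i)) (Finset.mem_range.1 hj)
      _ = _ := by
          simp only [Finset.sum_const, Finset.card_range, nsmul_eq_mul]
          ring
  have hp : 0 ≤ (∏ i ∈ Finset.range (n * d), (1 + |e i|)) *
      (∏ j ∈ Finset.range n, slopeFactor a b K (e ((j + 1) * d))) :=
    mul_nonneg (by positivity) (Finset.prod_nonneg fun _ _ => (slopeFactor_pos ha hb _ _).le)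
  refine (mul_le_mul_of_nonneg_left hwn hp).trans (le_of_eq ?_)
  rw [blockProd, add_mul n 1 d, one_mul, Finset.prod_range_add]
  ring

end

section

/-! ### Comparison of two autoregressions driven by the same noise -/

/-- Mean value inequality in the `ℓ¹` distance. Bounding the slopes on the segment only is what
allows the small constant far from the origin. -/
theorem abs_sub_le_of_partialDeriv_le {d : ℕ} {g : ℝ → (Fin d → ℝ) → ℝ} {u c : ℝ}
    (hg : ContDiff ℝ 1 (g u)) (x y : Fin d → ℝ)
    (h : ∀ τ ∈ Set.Icc (0 : ℝ) 1, ∀ j, |partialDeriv g j u (y + τ • (x - y))| ≤ c) :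
    |g u x - g u y| ≤ c * ∑ j, |x j - y j| := by
  have hd : ∀ τ : ℝ, HasDerivAt (fun τ : ℝ => g u (y + τ • (x - y)))
      (fderiv ℝ (g u) (y + τ • (x - y)) (x - y)) τ := by
    intro τ
    have h1 : HasDerivAt (fun τ : ℝ => y + τ • (x - y)) (x - y) τ := by
      simpa using ((hasDerivAt_id τ).smul_const (x - y)).const_add y
    exact ((hg.differentiable one_ne_zero) _).hasFDerivAt.comp_hasDerivAt τ h1
  have hb : ∀ τ ∈ Set.Ico (0 : ℝ) 1,
      ‖fderiv ℝ (g u) (y + τ • (x - y)) (x - y)‖ ≤ c * ∑ j, |x j - y j| := by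
    intro τ hτ
    have hsum : x - y = ∑ j, (x j - y j) • (Pi.single j 1 : Fin d → ℝ) := by
      ext i
      simp [Finset.sum_apply, Pi.single_apply]
    generalize hL : fderiv ℝ (g u) (y + τ • (x - y)) = L
    have hLj : ∀ j, |L (Pi.single j 1)| ≤ c := by
      intro j
      have := h τ ⟨hτ.1, hτ.2.le⟩ j
      rwa [partialDeriv, hL] at this
    rw [hsum, map_sum, Finset.mul_sum]
    refine (norm_sum_le _ _).trans (Finset.sum_le_sum fun j _ => ?_)
    rw [map_smul, norm_smul, Real.norm_eq_abs, Real.norm_eq_abs, mul_comm]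
    exact mul_le_mul_of_nonneg_right (hLj j) (abs_nonneg _)
  have := norm_image_sub_le_of_norm_deriv_le_segment_01'
    (fun τ _ => (hd τ).hasDerivWithinAt) hb
  simpa [Real.norm_eq_abs] using this

/-- `x` is of the form `m(v, z) + σ(v, z) e` for some `v` and `z`. -/
def NoiseDriven {d : ℕ} (m σ : ℝ → (Fin d → ℝ) → ℝ) (e x : ℝ) : Prop :=
  ∃ v z, x = m v z + σ v z * e

variable {d : ℕ} {m σ : ℝ → (Fin d → ℝ) → ℝ} {mUp σLow σUp K₁ δ : ℝ}

theorem NoiseDriven.abs_le {e x : ℝ} (hM : CondM m mUp K₁ δ) (hS : CondSigma σ σLow σUp K₁ δ)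
    (h : NoiseDriven m σ e x) : |x| ≤ (mUp + σUp) * (1 + |e|) := by
  obtain ⟨v, z, rfl⟩ := h
  have h1 := hM.bounded v z
  obtain ⟨h2, h3⟩ := hS.bounded v z
  have h0 := hS.low_pos
  have h4 : |σ v z * e| ≤ σUp * |e| := by
    rw [abs_mul, abs_of_pos (by linarith)]
    gcongr
  have := abs_add_le (m v z) (σ v z * e)
  have hm : 0 ≤ mUp := (abs_nonneg _).trans h1
  nlinarith [abs_nonneg e]

theorem NoiseDriven.lt_of_pos {e x : ℝ} (hM : CondM m mUp K₁ δ)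
    (hS : CondSigma σ σLow σUp K₁ δ) (h : NoiseDriven m σ e x) (he : 0 ≤ e)
    (hK : (K₁ + mUp) / σLow < |e|) : K₁ < x := by
  obtain ⟨v, z, rfl⟩ := h
  have h1 := _root_.abs_le.1 (hM.bounded v z)
  obtain ⟨h2, h3⟩ := hS.bounded v z
  rw [div_lt_iff₀ hS.low_pos, abs_of_nonneg he] at hK
  nlinarith

theorem NoiseDriven.lt_neg_of_nonpos {e x : ℝ} (hM : CondM m mUp K₁ δ)
    (hS : CondSigma σ σLow σUp K₁ δ) (h : NoiseDriven m σ e x) (he : e ≤ 0)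
    (hK : (K₁ + mUp) / σLow < |e|) : K₁ < -x := by
  obtain ⟨v, z, rfl⟩ := h
  have h1 := _root_.abs_le.1 (hM.bounded v z)
  obtain ⟨h2, h3⟩ := hS.bounded v z
  rw [div_lt_iff₀ hS.low_pos, abs_of_nonpos he] at hK
  nlinarith

/-- A single large noise variable keeps the whole segment between two vectors outside the
ball of radius `K₁`. -/
theorem lt_norm_segment {e : ℝ} (hM : CondM m mUp K₁ δ) (hS : CondSigma σ σLow σUp K₁ δ)
    {x y : Fin d → ℝ} (j : Fin d) (hx : NoiseDriven m σ e (x j)) (hy : NoiseDriven m σ e (y j))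
    (hK : (K₁ + mUp) / σLow < |e|) {τ : ℝ} (hτ : τ ∈ Set.Icc (0 : ℝ) 1) :
    K₁ < ‖y + τ • (x - y)‖ := by
  refine lt_of_lt_of_le ?_ (norm_le_pi_norm _ j)
  have heq : (y + τ • (x - y)) j = (1 - τ) * y j + τ * x j := by
    simp; ring
  rw [heq, Real.norm_eq_abs]
  obtain ⟨h0, h1⟩ := hτ
  rcases le_total 0 e with he | he
  · have hx := hx.lt_of_pos hM hS he hK
    have hy := hy.lt_of_pos hM hS he hK
    refine lt_of_lt_of_le ?_ (le_abs_self _)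
    rcases lt_or_eq_of_le h1 with h | rfl <;> nlinarith
  · have hx := hx.lt_neg_of_nonpos hM hS he hK
    have hy := hy.lt_neg_of_nonpos hM hS he hK
    refine lt_of_lt_of_le ?_ (neg_le_abs _)
    rcases lt_or_eq_of_le h1 with h | rfl <;> nlinarith

/-- The passage from `(s, x)` to `(u, y)` goes through `(u, x)`, so slopes are needed only at the
frozen time `u`. -/
theorem abs_step_sub_le {L s u e c : ℝ} {x y : Fin d → ℝ}
    (hm : ContDiff ℝ 1 (m u)) (hσ : ContDiff ℝ 1 (σ u))
    (hmL : ∀ u u' y, |m u y - m u' y| ≤ L * |u - u'|)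
    (hσL : ∀ u u' y, |σ u y - σ u' y| ≤ L * |u - u'|)
    (hm' : ∀ τ ∈ Set.Icc (0 : ℝ) 1, ∀ j, |partialDeriv m j u (y + τ • (x - y))| ≤ c)
    (hσ' : ∀ τ ∈ Set.Icc (0 : ℝ) 1, ∀ j, |partialDeriv σ j u (y + τ • (x - y))| ≤ c) :
    |(m s x + σ s x * e) - (m u y + σ u y * e)| ≤
      (1 + |e|) * (c * ∑ j, |x j - y j| + L * |s - u|) := by
  have h1 := abs_sub_le_of_partialDeriv_le hm x y hm'
  have h2 := abs_sub_le_of_partialDeriv_le hσ x y hσ'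
  have h3 := hmL s u x
  have h4 := hσL s u x
  have h5 : |m s x - m u y| ≤ c * ∑ j, |x j - y j| + L * |s - u| := by
    have := abs_sub_le (m s x) (m u x) (m u y)
    linarith
  have h6 : |σ s x - σ u y| ≤ c * ∑ j, |x j - y j| + L * |s - u| := by
    have := abs_sub_le (σ s x) (σ u x) (σ u y)
    linarith
  have heq : (m s x + σ s x * e) - (m u y + σ u y * e) =
      (m s x - m u y) + (σ s x - σ u y) * e := by ring
  rw [heq]
  refine (abs_add_le _ _).trans ?_
  rw [abs_mul]
  nlinarith [mul_le_mul_of_nonneg_right h6 (abs_nonneg e)]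

/-- Comparison of two noise driven sequences, indexed backwards in time, which satisfy
autoregressive equations during the last `n` blocks of length `d`. -/
theorem abs_sub_le_sum_blockProd (hd : 1 ≤ d) (hM : CondM m mUp K₁ δ)
    (hS : CondSigma σ σLow σUp K₁ δ) {Δ δ' L : ℝ}
    (hΔm : ∀ j u y, |partialDeriv m j u y| ≤ Δ) (hΔσ : ∀ j u y, |partialDeriv σ j u y| ≤ Δ)
    (hmL : ∀ u u' y, |m u y - m u' y| ≤ L * |u - u'|)
    (hσL : ∀ u u' y, |σ u y - σ u' y| ≤ L * |u - u'|)
    (hδδ' : δ ≤ δ') (hδ' : 0 < δ') (hδ'C : δ' * slopeConst d ≤ 1) (hδ'1 : δ' ≤ 1)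
    {c u : ℝ} (hc : 0 ≤ c) {x y e s : ℕ → ℝ} (n : ℕ)
    (hx : ∀ i, NoiseDriven m σ (e i) (x i)) (hy : ∀ i, NoiseDriven m σ (e i) (y i))
    (hxr : ∀ i < n * d, x i = m (s i) (fun j => x (i + 1 + j)) +
      σ (s i) (fun j => x (i + 1 + j)) * e i)
    (hyr : ∀ i < n * d, y i = m u (fun j => y (i + 1 + j)) + σ u (fun j => y (i + 1 + j)) * e i)
    (hs : ∀ i < n * d, L * |s i - u| ≤ c * (i + 1)) :
    |x 0 - y 0| ≤ c * ((((1 + Δ) ^ d + 1) * d) * d) *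
        ∑ k ∈ Finset.range n, (k + 1) *
          blockProd d ((1 + Δ) ^ d) (δ' * slopeConst d) ((K₁ + mUp) / σLow) e k +
      (d * (2 * (mUp + σUp))) *
        blockProd d ((1 + Δ) ^ d) (δ' * slopeConst d) ((K₁ + mUp) / σLow) e n := by
  have hΔ : 0 ≤ Δ := (abs_nonneg _).trans (hΔm ⟨0, hd⟩ 0 0)
  have hsum : ∀ i, ∑ j : Fin d, |x (i + 1 + j) - y (i + 1 + j)| =
      ∑ j ∈ Finset.range d, |x (i + 1 + j) - y (i + 1 + j)| :=
    fun i => Fin.sum_univ_eq_sum_range (fun j => |x (i + 1 + j) - y (i + 1 + j)|) d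
  refine head_le_sum_blockProd (D := fun i => |x i - y i|) hd (fun i => abs_nonneg _) hΔ hδ'
    hδ'C hδ'1 hc n ?_ ?_ ?_
  · intro i hi
    rw [hxr i hi, hyr i hi, ← hsum]
    refine (abs_step_sub_le (hM.slopes.1 u) (hS.slopes.1 u) hmL hσL
      (fun τ _ j => hΔm j u _) (fun τ _ j => hΔσ j u _)).trans ?_
    have := hs i hi
    gcongr
  · intro i hi j hj hK
    rw [hxr i hi, hyr i hi, ← hsum]
    have hseg : ∀ τ ∈ Set.Icc (0 : ℝ) 1, _ := fun τ hτ =>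
      lt_norm_segment hM hS (x := fun j : Fin d => x (i + 1 + j))
        (y := fun j : Fin d => y (i + 1 + j)) ⟨j, hj⟩ (hx _) (hy _) hK hτ
    refine (abs_step_sub_le (c := δ') (hM.slopes.1 u) (hS.slopes.1 u) hmL hσL
      (fun τ hτ j => (hM.slopes.2.2 j u _ (hseg τ hτ)).trans hδδ')
      (fun τ hτ j => (hS.slopes.2.2 j u _ (hseg τ hτ)).trans hδδ')).trans ?_
    have := hs i hi
    gcongr
  · intro i
    have h1 := (hx i).abs_le hM hS
    have h2 := (hy i).abs_le hM hS
    have := abs_sub (x i) (y i)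
    linarith

end

section

/-! ### Moments of the block products -/

-- At `s = 0` the weighted sum equals `p + q = 1`, and its derivative there is the given negative
-- number.
open Filter Topology in
theorem exists_pos_weighted_rpow_lt_one {p q x y : ℝ} (hpq : p + q = 1) (hx : 0 < x) (hy : 0 < y)
    (h : p * Real.log x + q * Real.log y < 0) :
    ∃ s : ℝ, 0 < s ∧ p * x ^ s + q * y ^ s < 1 := by
  have h1 : HasDerivAt (fun s : ℝ => p * x ^ s + q * y ^ s)
      (p * Real.log x + q * Real.log y) 0 := by
    have hx' := (Real.hasStrictDerivAt_const_rpow hx 0).hasDerivAt.const_mul p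
    have hy' := (Real.hasStrictDerivAt_const_rpow hy 0).hasDerivAt.const_mul q
    simpa using! hx'.add hy'
  have h2 := (hasDerivAt_iff_tendsto_slope.1 h1).eventually_lt_const h
  have h3 : ∀ᶠ s in 𝓝[>] (0 : ℝ), slope (fun s : ℝ => p * x ^ s + q * y ^ s) 0 s < 0 :=
    h2.filter_mono (nhdsWithin_mono _ fun s hs => ne_of_gt hs)
  obtain ⟨s, hs, hs0⟩ := (h3.and self_mem_nhdsWithin).exists
  refine ⟨s, hs0, ?_⟩
  have hs0' : 0 < s := hs0
  rw [slope_def_field, div_lt_iff₀ (by simpa using hs0')] at hs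
  simp at hs
  linarith

theorem one_le_slopeConst {d : ℕ} (hd : 1 ≤ d) : (1 : ℝ) ≤ slopeConst d := by
  rw [slopeConst_eq_sum]
  exact Finset.single_le_sum (f := fun q => (2 : ℝ) ^ q) (fun _ _ => by positivity)
    (Finset.mem_range.2 hd) |>.trans' (by simp)

/-- The bound on the slopes leaves room for a positive `δ' ≥ δ` such that the growth rate
over one block is negative. -/
theorem exists_slope_log_neg {d : ℕ} (hd : 1 ≤ d) {E Δ κ p δ : ℝ} (hE : 0 ≤ E) (hΔ : 0 ≤ Δ)
    (hpκ : p < κ) (hp : 0 ≤ p) (hκ : κ < 1)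
    (hδ : δ < ((1 + E) ^ ((d : ℝ) / (1 - κ)) * (Δ + 1) ^ (κ * (d : ℝ) / (1 - κ)) *
      (slopeConst d : ℝ))⁻¹) :
    ∃ δ' : ℝ, δ ≤ δ' ∧ 0 < δ' ∧ δ' ≤ 1 ∧ δ' * slopeConst d ≤ 1 ∧
      p * Real.log ((1 + Δ) ^ d * (1 + E) ^ d) +
        (1 - p) * Real.log (δ' * slopeConst d * (1 + E) ^ d) < 0 := by
  have hC := one_le_slopeConst hd
  set C : ℝ := (slopeConst d : ℝ)
  have hκ' : 0 < 1 - κ := by linarith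
  have hκ0 : 0 < κ := by linarith
  have hx : 1 ≤ (1 + E) ^ ((d : ℝ) / (1 - κ)) :=
    Real.one_le_rpow (by linarith) (by positivity)
  have hy : 1 ≤ (Δ + 1) ^ (κ * (d : ℝ) / (1 - κ)) :=
    Real.one_le_rpow (by linarith) (by positivity)
  have lx : Real.log ((1 + E) ^ ((d : ℝ) / (1 - κ))) = (d : ℝ) / (1 - κ) * Real.log (1 + E) :=
    Real.log_rpow (by linarith) _
  have ly : Real.log ((Δ + 1) ^ (κ * (d : ℝ) / (1 - κ)))
      = κ * (d : ℝ) / (1 - κ) * Real.log (Δ + 1) := Real.log_rpow (by linarith) _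
  set x := (1 + E) ^ ((d : ℝ) / (1 - κ))
  set y := (Δ + 1) ^ (κ * (d : ℝ) / (1 - κ))
  have hR : 0 < (x * y * C)⁻¹ := by positivity
  -- Taking `δ'` above `0` as well as above `δ` keeps its logarithm meaningful.
  obtain ⟨δ', h1, h2⟩ := exists_between (max_lt hδ hR)
  have hδ0 : 0 < δ' := (le_max_right _ _).trans_lt h1
  have hxy : 1 ≤ x * y := one_le_mul_of_one_le_of_one_le hx hy
  have h3 : x * y * (δ' * C) < 1 := by
    rw [lt_inv_comm₀ hδ0 (by positivity), lt_inv_comm₀ (by positivity) hδ0] at h2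
    have := mul_lt_mul_of_pos_left h2 (show 0 < x * y * C by positivity)
    rw [mul_inv_cancel₀ (by positivity)] at this
    linarith
  have h4 : δ' * C ≤ 1 := by nlinarith [show 0 < δ' * C by positivity]
  refine ⟨δ', ((le_max_left _ _).trans_lt h1).le, hδ0, ?_, h4, ?_⟩
  · nlinarith
  have h5 : Real.log x + Real.log y + Real.log (δ' * C) < 0 := by
    rw [← Real.log_mul (by positivity) (by positivity),
      ← Real.log_mul (by positivity) (by positivity)]
    exact Real.log_neg (by positivity) h3
  have h6 : Real.log (δ' * C) ≤ 0 := Real.log_nonpos (by positivity) h4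
  have lE : 0 ≤ Real.log (1 + E) := Real.log_nonneg (by linarith)
  have lΔ : 0 ≤ Real.log (Δ + 1) := Real.log_nonneg (by linarith)
  have h7 : (d : ℝ) * Real.log (1 + E) + κ * d * Real.log (Δ + 1) +
      (1 - κ) * Real.log (δ' * C) < 0 := by
    have := mul_neg_of_pos_of_neg hκ' h5
    rw [lx, ly] at this
    have e1 : (1 - κ) * ((d : ℝ) / (1 - κ) * Real.log (1 + E) +
        κ * (d : ℝ) / (1 - κ) * Real.log (Δ + 1) + Real.log (δ' * C)) =
        (d : ℝ) * Real.log (1 + E) + κ * d * Real.log (Δ + 1) +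
      (1 - κ) * Real.log (δ' * C) := by field_simp
    rwa [e1] at this
  rw [Real.log_mul (by positivity) (by positivity), Real.log_mul (by positivity) (by positivity),
    Real.log_pow, Real.log_pow, add_comm 1 Δ]
  -- Replacing `p` by the larger `κ` only increases the expression, since `log (Δ + 1) ≥ 0` and `log
  -- (δ' * C) ≤ 0`.
  have h8 : p * (d * Real.log (Δ + 1)) ≤ κ * (d * Real.log (Δ + 1)) := by gcongr
  have h9 : (1 - p) * Real.log (δ' * C) ≤ (1 - κ) * Real.log (δ' * C) := by nlinarith
  nlinarith

variable {Ω : Type*} [MeasurableSpace Ω] {μ : Measure Ω}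

theorem measurable_slopeFactor (a b K : ℝ) : Measurable (slopeFactor a b K) :=
  Measurable.ite (measurableSet_lt measurable_const measurable_norm) measurable_const
    measurable_const

theorem measurable_blockProd (d : ℕ) (a b K : ℝ) (k : ℕ) :
    Measurable fun e : ℕ → ℝ => blockProd d a b K e k := by
  have := measurable_slopeFactor a b K
  unfold blockProd
  refine Measurable.mul (Finset.measurable_prod _ fun i _ => ?_)
    (Finset.measurable_prod _ fun i _ => ?_)
  · exact measurable_const.add (measurable_pi_apply i).abs
  · exact this.comp (measurable_pi_apply _)

/-- Hölder's inequality for the block products of an i.i.d. noise sequence. -/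
theorem lintegral_blockProd_rpow_le [IsProbabilityMeasure μ] {d : ℕ} (hd : 1 ≤ d)
    {a b K s : ℝ} (ha : 0 < a) (hb : 0 < b) (hs : 0 < s) {ξ : Ω → ℝ} (hξ : Integrable ξ μ)
    {e : ℕ → Ω → ℝ} (he : ∀ i, Measurable (e i)) (hind : iIndepFun e μ)
    (hid : ∀ i, IdentDistrib (e i) ξ μ μ) (k : ℕ) :
    ∫⁻ ω, ENNReal.ofReal (blockProd d a b K (fun i => e i ω) k) ^ (s / (1 + s)) ∂μ ≤
      ENNReal.ofReal ((((1 + ∫ ω, |ξ ω| ∂μ) ^ d) ^ (k + 1)) ^ (s / (1 + s)) *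
        ((μ.real {ω | |ξ ω| ≤ K} * a ^ s + (1 - μ.real {ω | |ξ ω| ≤ K}) * b ^ s) ^ k) ^
          (1 / (1 + s))) := by
  set E := ∫ ω, |ξ ω| ∂μ
  have hE : 0 ≤ E := integral_nonneg fun _ => abs_nonneg _
  set p := μ.real {ω | |ξ ω| ≤ K}
  have hp1 : p ≤ 1 := measureReal_le_one
  have hp0 : 0 ≤ p := measureReal_nonneg
  have hsf := measurable_slopeFactor a b K
  have hsp : ∀ x, 0 < slopeFactor a b K x := slopeFactor_pos ha hb K
  have hρ : 0 ≤ s / (1 + s) := by positivity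
  have hP : ∀ i, ∫⁻ ω, ENNReal.ofReal (1 + |e i ω|) ∂μ = ENNReal.ofReal (1 + E) := by
    intro i
    have h1 : IdentDistrib (fun ω => ENNReal.ofReal (1 + |e i ω|))
        (fun ω => ENNReal.ofReal (1 + |ξ ω|)) μ μ :=
      (hid i).comp (u := fun x => ENNReal.ofReal (1 + |x|)) (by fun_prop)
    have h2 : Integrable (fun ω => 1 + |ξ ω|) μ := (integrable_const _).add hξ.abs
    have h3 : 0 ≤ᵐ[μ] fun ω => 1 + |ξ ω| := ae_of_all _ fun ω => by
      have := abs_nonneg (ξ ω)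
      simp only [Pi.zero_apply]
      linarith
    rw [h1.lintegral_eq, ← ofReal_integral_eq_lintegral_ofReal h2 h3,
      integral_add (integrable_const _) hξ.abs]
    simp [E]
  have hQ : ∀ i, ∫⁻ ω, ENNReal.ofReal (slopeFactor a b K (e i ω) ^ s) ∂μ =
      ENNReal.ofReal (p * a ^ s + (1 - p) * b ^ s) := by
    intro i
    have h1 : IdentDistrib (fun ω => ENNReal.ofReal (slopeFactor a b K (e i ω) ^ s))
        (fun ω => ENNReal.ofReal (slopeFactor a b K (ξ ω) ^ s)) μ μ :=
      (hid i).comp (u := fun x => ENNReal.ofReal (slopeFactor a b K x ^ s))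
        (hsf.pow_const s).ennreal_ofReal
    have hξm : AEMeasurable ξ μ := hξ.aemeasurable
    have hset : NullMeasurableSet {ω | |ξ ω| ≤ K} μ :=
      nullMeasurableSet_le hξm.abs aemeasurable_const
    have h2 : (fun ω => ENNReal.ofReal (slopeFactor a b K (ξ ω) ^ s)) = fun ω =>
        {ω | |ξ ω| ≤ K}.indicator (fun _ => ENNReal.ofReal (a ^ s)) ω +
        {ω | |ξ ω| ≤ K}ᶜ.indicator (fun _ => ENNReal.ofReal (b ^ s)) ω := by
      ext ω
      by_cases h : |ξ ω| ≤ K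
      · simp [slopeFactor, h, not_lt.2 h]
      · simp [slopeFactor, h, not_le.1 h]
    rw [h1.lintegral_eq, h2, lintegral_add_left' (aemeasurable_const.indicator₀ hset),
      lintegral_indicator_const₀ hset, lintegral_indicator_const₀ hset.compl,
      ENNReal.ofReal_add (by positivity) (mul_nonneg (by linarith) (by positivity)),
      ENNReal.ofReal_mul hp0, ENNReal.ofReal_mul (by linarith)]
    have h3 : μ.real {ω | |ξ ω| ≤ K}ᶜ = 1 - p := probReal_compl_eq_one_sub₀ hset
    rw [← h3, ofReal_measureReal, ofReal_measureReal, mul_comm, mul_comm (ENNReal.ofReal (b ^ s))]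
  have hinj : Function.Injective fun j : ℕ => (j + 1) * d := by
    intro i j hij
    have := Nat.eq_of_mul_eq_mul_right hd hij
    omega
  have hPind : iIndepFun (fun i ω => ENNReal.ofReal (1 + |e i ω|)) μ :=
    hind.comp (fun _ x => ENNReal.ofReal (1 + |x|)) (fun _ => by fun_prop)
  have hQind : iIndepFun (fun j ω => ENNReal.ofReal (slopeFactor a b K (e ((j + 1) * d) ω) ^ s))
      μ :=
    (hind.precomp hinj).comp (fun _ x => ENNReal.ofReal (slopeFactor a b K x ^ s))
      (fun _ => (hsf.pow_const s).ennreal_ofReal)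
  have hPm : ∀ i, Measurable fun ω => ENNReal.ofReal (1 + |e i ω|) :=
    fun i => (measurable_const.add (he i).abs).ennreal_ofReal
  have hQm : ∀ j, Measurable fun ω =>
      ENNReal.ofReal (slopeFactor a b K (e ((j + 1) * d) ω) ^ s) :=
    fun j => ((hsf.comp (he _)).pow_const s).ennreal_ofReal
  -- The two products share noise variables and are not independent of each other. Hölder with
  -- exponents `s / (1 + s)` and `1 / (1 + s)` separates them at the cost of only a first moment of
  -- the noise; within each product the factors are independent.
  have hsplit : ∀ ω, ENNReal.ofReal (blockProd d a b K (fun i => e i ω) k) ^ (s / (1 + s)) =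
      (∏ i ∈ Finset.range ((k + 1) * d), ENNReal.ofReal (1 + |e i ω|)) ^ (s / (1 + s)) *
      (∏ j ∈ Finset.range k, ENNReal.ofReal (slopeFactor a b K (e ((j + 1) * d) ω) ^ s)) ^
        (1 / (1 + s)) := by
    intro ω
    rw [blockProd, ENNReal.ofReal_mul (by positivity), ENNReal.mul_rpow_of_nonneg _ _ hρ,
      ENNReal.ofReal_prod_of_nonneg fun i _ => by positivity,
      ENNReal.ofReal_prod_of_nonneg fun i _ => (hsp _).le]
    congr 1
    rw [← ENNReal.prod_rpow_of_nonneg hρ, ← ENNReal.prod_rpow_of_nonneg (by positivity)]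
    refine Finset.prod_congr rfl fun j _ => ?_
    rw [ENNReal.ofReal_rpow_of_pos (hsp _), ENNReal.ofReal_rpow_of_pos (by
      exact Real.rpow_pos_of_pos (hsp _) _), ← Real.rpow_mul (hsp _).le]
    congr 2
    ring
  simp_rw [hsplit]
  refine (ENNReal.lintegral_mul_norm_pow_le
    (Finset.aemeasurable_fun_prod _ fun i _ => (hPm i).aemeasurable)
    (Finset.aemeasurable_fun_prod _ fun i _ => (hQm i).aemeasurable) hρ (by positivity)
    (by field_simp; ring)).trans (le_of_eq ?_)
  have hg : 0 < p * a ^ s + (1 - p) * b ^ s := by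
    have h1 : 0 < a ^ s := by positivity
    have h2 : 0 < b ^ s := by positivity
    rcases hp0.eq_or_lt with h | h
    · rw [← h]; simpa
    · have := mul_pos h h1
      have := mul_nonneg (sub_nonneg.2 hp1) h2.le
      linarith
  rw [lintegral_prod_eq_prod_lintegral_of_indepFun _ _ hPind hPm,
    lintegral_prod_eq_prod_lintegral_of_indepFun _ _ hQind hQm]
  simp_rw [hP, hQ]
  rw [Finset.prod_const, Finset.prod_const, Finset.card_range, Finset.card_range,
    ENNReal.ofReal_mul (by positivity), ← ENNReal.ofReal_pow (by positivity),
    ← ENNReal.ofReal_pow hg.le, ENNReal.ofReal_rpow_of_pos (by positivity),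
    ENNReal.ofReal_rpow_of_pos (by positivity), ← pow_mul, mul_comm d]

/-- The weighted sum of all block products. -/
def blockSeries (d : ℕ) (a b K : ℝ) (e : ℕ → ℝ) : ENNReal :=
  ∑' k : ℕ, ENNReal.ofReal ((k + 1) * blockProd d a b K e k)

theorem measurable_blockSeries (d : ℕ) (a b K : ℝ) :
    Measurable fun e : ℕ → ℝ => blockSeries d a b K e :=
  Measurable.tsum fun k =>
    (measurable_const.mul (measurable_blockProd d a b K k)).ennreal_ofReal

theorem tsum_rpow_le_tsum {ρ : ℝ} (h0 : 0 < ρ) (h1 : ρ ≤ 1) (f : ℕ → ENNReal) :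
    (∑' k, f k) ^ ρ ≤ ∑' k, f k ^ ρ := by
  have hfin : ∀ n, (∑ k ∈ Finset.range n, f k) ^ ρ ≤ ∑' k, f k ^ ρ := by
    intro n
    refine le_trans ?_ (ENNReal.sum_le_tsum (Finset.range n))
    induction n with
    | zero => simp [h0]
    | succ n ih =>
      rw [Finset.sum_range_succ, Finset.sum_range_succ]
      exact (ENNReal.rpow_add_le_add_rpow _ _ h0.le h1).trans (by gcongr)
  have ht := (ENNReal.continuous_rpow_const (y := ρ)).continuousAt.tendsto.comp
    (ENNReal.tendsto_nat_tsum f)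
  exact le_of_tendsto' ht hfin

/-- Each further block multiplies the Hölder bound by `r = (M ^ s * g) ^ (1 / (1 + s))`, and `r < 1`
for the small `s` provided by the negative logarithmic mean. Subadditivity of `x ↦ x ^ ρ` then sums
the moments term by term. The bound depends only on the law of the noise, hence is uniform in time.
-/
theorem exists_blockSeries_moment [IsProbabilityMeasure μ] {d : ℕ} (hd : 1 ≤ d)
    {a b K : ℝ} (ha : 0 < a) (hb : 0 < b) {ξ : Ω → ℝ} (hξ : Integrable ξ μ)
    (hlog : μ.real {ω | |ξ ω| ≤ K} * Real.log (a * (1 + ∫ ω, |ξ ω| ∂μ) ^ d) +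
      (1 - μ.real {ω | |ξ ω| ≤ K}) * Real.log (b * (1 + ∫ ω, |ξ ω| ∂μ) ^ d) < 0) :
    ∃ ρ : ℝ, 0 < ρ ∧ ρ ≤ 1 ∧ ∃ C : ENNReal, C ≠ ⊤ ∧
      ∀ e : ℕ → Ω → ℝ, (∀ i, Measurable (e i)) → iIndepFun e μ →
        (∀ i, IdentDistrib (e i) ξ μ μ) →
        ∫⁻ ω, blockSeries d a b K (fun i => e i ω) ^ ρ ∂μ ≤ C := by
  set E := ∫ ω, |ξ ω| ∂μ
  have hE : 0 ≤ E := integral_nonneg fun _ => abs_nonneg _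
  set p := μ.real {ω | |ξ ω| ≤ K}
  have hp1 : p ≤ 1 := measureReal_le_one
  have hp0 : 0 ≤ p := measureReal_nonneg
  have hM : 0 < (1 + E) ^ d := by positivity
  obtain ⟨s, hs, hlt⟩ := exists_pos_weighted_rpow_lt_one (p := p) (q := 1 - p) (by ring)
    (mul_pos ha hM) (mul_pos hb hM) hlog
  set M := (1 + E) ^ d
  set g := p * a ^ s + (1 - p) * b ^ s
  have hg : 0 ≤ g := add_nonneg (by positivity) (mul_nonneg (by linarith) (by positivity))
  have hMg : M ^ s * g < 1 := by
    rw [Real.mul_rpow ha.le hM.le, Real.mul_rpow hb.le hM.le] at hlt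
    calc M ^ s * g = p * (a ^ s * M ^ s) + (1 - p) * (b ^ s * M ^ s) := by simp only [g]; ring
      _ < 1 := hlt
  have hρ0 : 0 < s / (1 + s) := by positivity
  have hρ1 : s / (1 + s) ≤ 1 := by rw [div_le_one (by positivity)]; linarith
  set r := M ^ (s / (1 + s)) * g ^ (1 / (1 + s))
  have hr0 : 0 ≤ r := by positivity
  have hr1 : r < 1 := by
    have h1 : r = (M ^ s * g) ^ (1 / (1 + s)) := by
      rw [Real.mul_rpow (by positivity) hg, ← Real.rpow_mul hM.le]
      simp only [r]; congr 2; ring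
    rw [h1]
    exact Real.rpow_lt_one (by positivity) hMg (by positivity)
  refine ⟨s / (1 + s), hρ0, hρ1,
    ∑' k : ℕ, ENNReal.ofReal (M ^ (s / (1 + s)) * ((k + 1) * r ^ k)), ?_, ?_⟩
  · refine Summable.tsum_ofReal_ne_top (Summable.mul_left _ ?_)
    have h1 : Summable fun k : ℕ => (k : ℝ) ^ 1 * r ^ k :=
      summable_pow_mul_geometric_of_norm_lt_one 1 (by rwa [Real.norm_of_nonneg hr0])
    simpa [add_mul] using h1.add (summable_geometric_of_lt_one hr0 hr1)
  · intro e he hind hid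
    have hme : Measurable fun ω i => e i ω := measurable_pi_iff.2 he
    calc ∫⁻ ω, blockSeries d a b K (fun i => e i ω) ^ (s / (1 + s)) ∂μ
        ≤ ∫⁻ ω, ∑' k : ℕ, ENNReal.ofReal ((k + 1) * blockProd d a b K (fun i => e i ω) k) ^
            (s / (1 + s)) ∂μ :=
          lintegral_mono fun ω => tsum_rpow_le_tsum hρ0 hρ1 _
      _ = ∑' k : ℕ, ∫⁻ ω, ENNReal.ofReal ((k + 1) * blockProd d a b K (fun i => e i ω) k) ^
            (s / (1 + s)) ∂μ :=
          lintegral_tsum fun k => (((measurable_const.mul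
            ((measurable_blockProd d a b K k).comp hme)).ennreal_ofReal).pow_const _).aemeasurable
      _ ≤ _ := by
          refine ENNReal.tsum_le_tsum fun k => ?_
          have h1 := lintegral_blockProd_rpow_le hd ha hb hs hξ he hind hid k (K := K)
          have hk : ENNReal.ofReal ((k : ℝ) + 1) ^ (s / (1 + s)) ≤ ENNReal.ofReal ((k : ℝ) + 1) := by
            conv_rhs => rw [← ENNReal.rpow_one (ENNReal.ofReal _)]
            exact ENNReal.rpow_le_rpow_of_exponent_le (by simp) hρ1
          have h2 : ∀ ω, ENNReal.ofReal ((k + 1) * blockProd d a b K (fun i => e i ω) k) ^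
              (s / (1 + s)) ≤ ENNReal.ofReal ((k : ℝ) + 1) *
                ENNReal.ofReal (blockProd d a b K (fun i => e i ω) k) ^ (s / (1 + s)) := by
            intro ω
            rw [ENNReal.ofReal_mul (by positivity), ENNReal.mul_rpow_of_nonneg _ _ hρ0.le]
            gcongr
          refine (lintegral_mono h2).trans ?_
          rw [lintegral_const_mul' _ _ ENNReal.ofReal_ne_top]
          refine (mul_le_mul_right h1 _).trans (le_of_eq ?_)
          rw [← ENNReal.ofReal_mul (by positivity)]
          congr 1
          change _ * ((M ^ (k + 1)) ^ (s / (1 + s)) * (g ^ k) ^ (1 / (1 + s))) = _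
          have e1 : (M ^ (k + 1)) ^ (s / (1 + s)) = (M ^ (s / (1 + s))) ^ (k + 1) :=
            (Real.rpow_pow_comm hM.le _ _).symm
          have e2 : (g ^ k) ^ (1 / (1 + s)) = (g ^ (1 / (1 + s))) ^ k :=
            (Real.rpow_pow_comm hg _ _).symm
          rw [e1, e2]
          simp only [r]
          rw [mul_pow]
          ring

end

section

/-! ### The frozen autoregression as a causal functional of the noise -/

theorem summable_of_blockSeries_ne_top {d : ℕ} {a b K : ℝ} (ha : 0 < a) (hb : 0 < b) {e : ℕ → ℝ}
    (h : blockSeries d a b K e ≠ ⊤) :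
    Summable fun k : ℕ => (k + 1) * blockProd d a b K e k := by
  have := ENNReal.summable_toReal h
  refine this.congr fun k => ENNReal.toReal_ofReal ?_
  have := blockProd_nonneg (d := d) ha hb K e k
  positivity

theorem tendsto_blockProd_of_blockSeries_ne_top {d : ℕ} {a b K : ℝ} (ha : 0 < a) (hb : 0 < b)
    {e : ℕ → ℝ} (h : blockSeries d a b K e ≠ ⊤) :
    Filter.Tendsto (blockProd d a b K e) Filter.atTop (nhds 0) := by
  refine squeeze_zero (fun k => blockProd_nonneg ha hb K e k) (fun k => ?_)
    (summable_of_blockSeries_ne_top ha hb h).tendsto_atTop_zero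
  have := blockProd_nonneg (d := d) ha hb K e k
  have hk : (0 : ℝ) ≤ k := k.cast_nonneg
  nlinarith

theorem sum_le_blockSeries {d : ℕ} {a b K : ℝ} (ha : 0 < a) (hb : 0 < b) {e : ℕ → ℝ}
    (h : blockSeries d a b K e ≠ ⊤) (n : ℕ) :
    ∑ k ∈ Finset.range n, (k + 1) * blockProd d a b K e k ≤ (blockSeries d a b K e).toReal := by
  have hnn : ∀ k : ℕ, 0 ≤ ((k : ℝ) + 1) * blockProd d a b K e k := fun k => by
    have := blockProd_nonneg (d := d) ha hb K e k
    positivity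
  rw [← ENNReal.ofReal_le_iff_le_toReal h, ENNReal.ofReal_sum_of_nonneg fun k _ => hnn k]
  exact ENNReal.sum_le_tsum _

variable {d : ℕ}

/-- The value at the present time of the autoregression frozen at `u` and started `n` steps ago,
as a function of the past noise `e 0, e 1, …`. -/
def startedSolution (m σ : ℝ → (Fin d → ℝ) → ℝ) (u : ℝ) : ℕ → (ℕ → ℝ) → ℝ
  | 0, e => m u 0 + σ u 0 * e 0
  -- Truncated subtraction gives all lags before the start the value of case `0`, which still
  -- contains its own noise variable. Thus every value is noise driven, as the comparison requires.
  | n + 1, e => m u (fun j => startedSolution m σ u (n - j) fun k => e (k + (1 + j))) +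
      σ u (fun j => startedSolution m σ u (n - j) fun k => e (k + (1 + j))) * e 0
  termination_by n => n
  decreasing_by all_goals omega

/-- The value at the present time of the stationary solution of the autoregression frozen
at `u`. -/
def stationarySolution (m σ : ℝ → (Fin d → ℝ) → ℝ) (u : ℝ) (e : ℕ → ℝ) : ℝ :=
  -- An upper limit is measurable in the noise without any convergence; it is the limit wherever the
  -- block series is finite.
  Filter.limsup (fun n => startedSolution m σ u n e) Filter.atTop

variable {m σ : ℝ → (Fin d → ℝ) → ℝ} {mUp σLow σUp K₁ δ : ℝ}

theorem measurable_startedSolution {u : ℝ} (hm : Continuous (m u)) (hσ : Continuous (σ u))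
    (n : ℕ) : Measurable (startedSolution m σ u n) := by
  induction n using Nat.strong_induction_on with
  | _ n ih =>
    cases n with
    | zero =>
      have : startedSolution m σ u 0 = fun e => m u 0 + σ u 0 * e 0 := by
        ext e; rw [startedSolution]
      rw [this]
      fun_prop
    | succ n =>
      have : startedSolution m σ u (n + 1) = fun e =>
          m u (fun j => startedSolution m σ u (n - j) fun k => e (k + (1 + j))) +
          σ u (fun j => startedSolution m σ u (n - j) fun k => e (k + (1 + j))) * e 0 := by
        ext e; rw [startedSolution]
      rw [this]
      have h1 : Measurable fun (e : ℕ → ℝ) (j : Fin d) =>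
          startedSolution m σ u (n - j) fun k => e (k + (1 + j)) :=
        measurable_pi_iff.2 fun j => (ih (n - j) (by omega)).comp
          (measurable_pi_iff.2 fun k => measurable_pi_apply _)
      exact (hm.measurable.comp h1).add ((hσ.measurable.comp h1).mul (measurable_pi_apply 0))

theorem measurable_stationarySolution {u : ℝ} (hm : Continuous (m u)) (hσ : Continuous (σ u)) :
    Measurable (stationarySolution m σ u) :=
  Measurable.limsup fun n => measurable_startedSolution hm hσ n

theorem noiseDriven_startedSolution (u : ℝ) (n : ℕ) (e : ℕ → ℝ) :
    NoiseDriven m σ (e 0) (startedSolution m σ u n e) := by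
  cases n <;> rw [startedSolution] <;> exact ⟨_, _, rfl⟩

theorem startedSolution_sub (u : ℝ) {n i : ℕ} (h : i < n) (e : ℕ → ℝ) :
    startedSolution m σ u (n - i) (fun k => e (k + i)) =
      m u (fun j => startedSolution m σ u (n - (i + 1 + j)) fun k => e (k + (i + 1 + j))) +
      σ u (fun j => startedSolution m σ u (n - (i + 1 + j)) fun k => e (k + (i + 1 + j))) *
        e i := by
  obtain ⟨p, hp⟩ : ∃ p, n - i = p + 1 := ⟨n - i - 1, by omega⟩
  have h1 : ∀ j : ℕ, p - j = n - (i + 1 + j) := fun j => by omega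
  have h2 : ∀ j k : ℕ, k + (1 + j) + i = k + (i + 1 + j) := fun j k => by omega
  rw [hp, startedSolution]
  simp only [h1, h2, zero_add]

/-- The constants occurring in the comparison of two autoregressions. -/
structure ContractionConst (m σ : ℝ → (Fin d → ℝ) → ℝ) (δ Δ δ' L : ℝ) : Prop where
  order_pos : 1 ≤ d
  slope_m : ∀ j u y, |partialDeriv m j u y| ≤ Δ
  slope_σ : ∀ j u y, |partialDeriv σ j u y| ≤ Δ
  lipschitz_m : ∀ u u' y, |m u y - m u' y| ≤ L * |u - u'|
  lipschitz_σ : ∀ u u' y, |σ u y - σ u' y| ≤ L * |u - u'|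
  le_slope : δ ≤ δ'
  slope_pos : 0 < δ'
  slope_mul_le : δ' * slopeConst d ≤ 1
  slope_le : δ' ≤ 1

namespace ContractionConst

variable {Δ δ' L : ℝ}

theorem deriv_nonneg (h : ContractionConst m σ δ Δ δ' L) : 0 ≤ Δ :=
  (abs_nonneg _).trans (h.slope_m ⟨0, h.order_pos⟩ 0 0)

theorem large_pos (h : ContractionConst m σ δ Δ δ' L) : 0 < (1 + Δ) ^ d := by
  have := h.deriv_nonneg
  positivity

theorem small_pos (h : ContractionConst m σ δ Δ δ' L) : 0 < δ' * slopeConst d :=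
  mul_pos h.slope_pos (zero_lt_one.trans_le (one_le_slopeConst h.order_pos))

theorem lipschitz_nonneg (h : ContractionConst m σ δ Δ δ' L) : 0 ≤ L := by
  have := (abs_nonneg _).trans (h.lipschitz_m 1 0 0)
  simpa using this

/-- The weighted sum of block products which belongs to the constants. -/
abbrev series (_ : ContractionConst m σ δ Δ δ' L) (K : ℝ) (e : ℕ → ℝ) : ENNReal :=
  blockSeries d ((1 + Δ) ^ d) (δ' * slopeConst d) K e

theorem tendsto_startedSolution (h : ContractionConst m σ δ Δ δ' L) (hM : CondM m mUp K₁ δ)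
    (hS : CondSigma σ σLow σUp K₁ δ) {e : ℕ → ℝ} (he : h.series ((K₁ + mUp) / σLow) e ≠ ⊤)
    (u : ℝ) :
    Filter.Tendsto (fun n => startedSolution m σ u n e) Filter.atTop
      (nhds (stationarySolution m σ u e)) := by
  have hcauchy : CauchySeq fun n => startedSolution m σ u n e := by
    -- Two starting times beyond `N` give sequences obeying the same frozen recursion on the last `N
    -- / d` blocks. With `c = 0` there is no time error and only the remainder is left.
    refine cauchySeq_of_le_tendsto_0 (fun N => (d * (2 * (mUp + σUp))) *
      blockProd d ((1 + Δ) ^ d) (δ' * slopeConst d) ((K₁ + mUp) / σLow) e (N / d)) ?_ ?_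
    · intro n n' N hn hn'
      have hN : N / d * d ≤ N := Nat.div_mul_le_self N d
      have := abs_sub_le_sum_blockProd h.order_pos hM hS h.slope_m h.slope_σ h.lipschitz_m
        h.lipschitz_σ h.le_slope h.slope_pos h.slope_mul_le h.slope_le (c := 0) (u := u) le_rfl
        (x := fun i => startedSolution m σ u (n - i) fun k => e (k + i))
        (y := fun i => startedSolution m σ u (n' - i) fun k => e (k + i))
        (e := e) (s := fun _ => u) (N / d)
        (fun i => by simpa using noiseDriven_startedSolution u (n - i) fun k => e (k + i))
        (fun i => by simpa using noiseDriven_startedSolution u (n' - i) fun k => e (k + i))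
        (fun i hi => startedSolution_sub u (by omega) e)
        (fun i hi => startedSolution_sub u (by omega) e)
        (fun i _ => by simp)
      simpa [Real.dist_eq] using this
    · have h1 := (tendsto_blockProd_of_blockSeries_ne_top h.large_pos h.small_pos he).comp
        (Nat.tendsto_div_const_atTop (Nat.pos_iff_ne_zero.1 h.order_pos))
      simpa using h1.const_mul (d * (2 * (mUp + σUp)) : ℝ)
  obtain ⟨x, hx⟩ := cauchySeq_tendsto_of_complete hcauchy
  rwa [stationarySolution, hx.limsup_eq]

/-- The recursion passes to the limit by continuity of `m u` and `σ u`. Convergence is needed along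
the shifted noise too, whence finiteness at every shift. -/
theorem stationarySolution_eq (h : ContractionConst m σ δ Δ δ' L) (hM : CondM m mUp K₁ δ)
    (hS : CondSigma σ σLow σUp K₁ δ) {e : ℕ → ℝ}
    (he : ∀ i, h.series ((K₁ + mUp) / σLow) (fun k => e (k + i)) ≠ ⊤) (u : ℝ) :
    stationarySolution m σ u e =
      m u (fun j => stationarySolution m σ u fun k => e (k + (1 + j))) +
      σ u (fun j => stationarySolution m σ u fun k => e (k + (1 + j))) * e 0 := by
  have h0 := (h.tendsto_startedSolution hM hS (by simpa using he 0) u).comp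
    (Filter.tendsto_add_atTop_nat 1)
  have h1 : Filter.Tendsto
      (fun (n : ℕ) (j : Fin d) => startedSolution m σ u (n - j) fun k => e (k + (1 + j)))
      Filter.atTop (nhds fun j => stationarySolution m σ u fun k => e (k + (1 + j))) :=
    tendsto_pi_nhds.2 fun j => (h.tendsto_startedSolution hM hS (he (1 + j)) u).comp
      (Filter.tendsto_sub_atTop_nat (j : ℕ))
  have hm := ((hM.slopes.1 u).continuous.tendsto _).comp h1
  have hσ := ((hS.slopes.1 u).continuous.tendsto _).comp h1
  refine tendsto_nhds_unique h0 ((hm.add (hσ.mul_const (e 0))).congr fun n => ?_)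
  simp only [Function.comp_apply]
  rw [startedSolution]

/-- Two complete solutions differ by at most a multiple of the series of block products. -/
theorem abs_sub_le (h : ContractionConst m σ δ Δ δ' L) (hM : CondM m mUp K₁ δ)
    (hS : CondSigma σ σLow σUp K₁ δ) {e : ℕ → ℝ} (he : h.series ((K₁ + mUp) / σLow) e ≠ ⊤)
    {c u : ℝ} (hc : 0 ≤ c) {x y s : ℕ → ℝ}
    (hxr : ∀ i, x i = m (s i) (fun j => x (i + 1 + j)) + σ (s i) (fun j => x (i + 1 + j)) * e i)
    (hyr : ∀ i, y i = m u (fun j => y (i + 1 + j)) + σ u (fun j => y (i + 1 + j)) * e i)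
    (hs : ∀ i : ℕ, L * |s i - u| ≤ c * (i + 1)) :
    |x 0 - y 0| ≤ c * ((((1 + Δ) ^ d + 1) * d) * d) *
      (h.series ((K₁ + mUp) / σLow) e).toReal := by
  -- The remainder after `n` blocks vanishes as `n` grows, because the terms of a finite series tend
  -- to zero.
  have h0 := ((tendsto_blockProd_of_blockSeries_ne_top h.large_pos h.small_pos he).const_mul
    (d * (2 * (mUp + σUp)) : ℝ)).const_add (c * ((((1 + Δ) ^ d + 1) * d) * d) *
      (h.series ((K₁ + mUp) / σLow) e).toReal)
  rw [mul_zero, add_zero] at h0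
  refine ge_of_tendsto' h0 fun n => ?_
  refine (abs_sub_le_sum_blockProd h.order_pos hM hS h.slope_m h.slope_σ h.lipschitz_m
        h.lipschitz_σ h.le_slope h.slope_pos h.slope_mul_le h.slope_le hc n
        (fun i => ⟨_, _, hxr i⟩) (fun i => ⟨_, _, hyr i⟩) (fun i _ => hxr i) (fun i _ => hyr i)
        fun i _ => hs i).trans ?_
  have := h.large_pos
  gcongr
  exact sum_le_blockSeries h.large_pos h.small_pos he n

end ContractionConst

end

section

/-! ### Independent and identically distributed noise -/

variable {Ω : Type*} [MeasurableSpace Ω] {μ : Measure Ω} {ε : ℤ → Ω → ℝ}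

/-- The noise up to time `t`, indexed backwards in time. -/
def pastNoise (ε : ℤ → Ω → ℝ) (t : ℤ) (ω : Ω) : ℕ → ℝ := fun k => ε (t - k) ω

theorem CondE.measurable_pastNoise (hE : CondE μ ε) (t : ℤ) : Measurable (pastNoise ε t) :=
  measurable_pi_iff.2 fun _ => hE.measurable _

theorem CondE.integrable [IsProbabilityMeasure μ] (hE : CondE μ ε) : Integrable (ε 0) μ := by
  obtain ⟨η, hη, hi⟩ := hE.moment
  refine Integrable.mono' ((integrable_const (1 : ℝ)).add hi) (hE.measurable 0).aestronglyMeasurable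
    (ae_of_all _ fun ω => ?_)
  simp only [Pi.add_apply, Real.norm_eq_abs]
  rcases le_total |ε 0 ω| 1 with h | h
  · have : 0 ≤ |ε 0 ω| ^ (1 + η) := by positivity
    linarith
  · have := Real.rpow_le_rpow_of_exponent_le h (show (1 : ℝ) ≤ 1 + η by linarith)
    rw [Real.rpow_one] at this
    linarith

theorem CondE.iIndepFun_past (hE : CondE μ ε) (t : ℤ) :
    iIndepFun (fun (k : ℕ) => ε (t - k)) μ :=
  hE.indep.precomp (g := fun k : ℕ => t - (k : ℤ)) fun i j h => by simpa using h

theorem CondE.indepFun_past [IsProbabilityMeasure μ] (hE : CondE μ ε) (t : ℤ) :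
    IndepFun (pastNoise ε (t - 1)) (ε t) μ := by
  refine IndepFun.process_indepFun (fun k => hE.measurable _) (hE.measurable t) fun I => ?_
  have hinj : Function.Injective fun k : ℕ => t - 1 - (k : ℤ) := fun i j h => by simpa using h
  have hdisj : Disjoint (I.map ⟨_, hinj⟩) ({t} : Finset ℤ) := by
    rw [Finset.disjoint_singleton_right, Finset.mem_map]
    rintro ⟨k, -, hk⟩
    simp only [Function.Embedding.coeFn_mk] at hk
    omega
  have h := hE.indep.indepFun_finset _ _ hdisj hE.measurable
  have hφ : Measurable fun (v : I.map ⟨_, hinj⟩ → ℝ) (i : I) =>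
      v ⟨t - 1 - ((i : ℕ) : ℤ), Finset.mem_map_of_mem ⟨_, hinj⟩ i.2⟩ :=
    measurable_pi_iff.2 fun _ => measurable_pi_apply _
  have hψ : Measurable fun v : ({t} : Finset ℤ) → ℝ => v ⟨t, Finset.mem_singleton_self t⟩ :=
    measurable_pi_apply _
  exact h.comp hφ hψ

/-- Both joint laws are the infinite product of the common marginal law. -/
theorem CondE.map_shift [IsProbabilityMeasure μ] (hE : CondE μ ε) (h : ℤ) :
    μ.map (fun ω (z : ℤ) => ε (z + h) ω) = μ.map (fun ω (z : ℤ) => ε z ω) := by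
  have h1 := hE.indep.precomp (g := fun z : ℤ => z + h) (add_left_injective h)
  rw [hE.indep.map_fun_eq_infinitePi_map hE.measurable,
    iIndepFun.map_fun_eq_infinitePi_map (X := fun z => ε (z + h)) (fun z => hE.measurable _) h1]
  congr 1
  ext1 z
  rw [(hE.identDistrib (z + h)).map_eq, (hE.identDistrib z).map_eq]

/-- A causal functional of i.i.d. noise is strictly stationary. -/
theorem CondE.isStrictlyStationary [IsProbabilityMeasure μ] (hE : CondE μ ε) {F : (ℕ → ℝ) → ℝ}
    (hF : Measurable F) : IsStrictlyStationary μ fun t ω => F (pastNoise ε t ω) := by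
  refine ⟨fun t => hF.comp (hE.measurable_pastNoise t), fun n s h => ?_⟩
  set Φ : (ℤ → ℝ) → Fin n → ℝ := fun z i => F fun k : ℕ => z (s i - k)
  have hΦ : Measurable Φ := measurable_pi_iff.2 fun i =>
    hF.comp (measurable_pi_iff.2 fun k => measurable_pi_apply _)
  have h1 : (fun ω i => F (pastNoise ε (s i + h) ω)) = Φ ∘ fun ω (z : ℤ) => ε (z + h) ω := by
    ext ω i
    simp only [Φ, Function.comp_apply]
    congr 1
    ext k
    simp only [pastNoise]
    congr 1
    ring
  have h2 : (fun ω i => F (pastNoise ε (s i) ω)) = Φ ∘ fun ω (z : ℤ) => ε z ω := rfl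
  rw [h1, h2, ← Measure.map_map hΦ (measurable_pi_iff.2 fun z => hE.measurable _),
    ← Measure.map_map hΦ (measurable_pi_iff.2 fun z => hE.measurable _), hE.map_shift h]

/-- An affine function of the present noise whose coefficients depend on the past has a density. -/
theorem CondE.hasPDF [IsProbabilityMeasure μ] (hE : CondE μ ε) {α : Type*} [MeasurableSpace α]
    {t : ℤ} {Z : Ω → ℝ} {W : Ω → α} {a b : α → ℝ} (hZ : Measurable Z) (hW : Measurable W)
    (ha : Measurable a) (hb : Measurable b) (hb0 : ∀ w, b w ≠ 0) (hind : IndepFun W (ε t) μ)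
    (h : ∀ᵐ ω ∂μ, Z ω = a (W ω) + b (W ω) * ε t ω) : HasPDF Z μ volume := by
  rw [Real.hasPDF_iff_of_aemeasurable hZ.aemeasurable]
  obtain ⟨f, -, -, hf⟩ := hE.density
  have hac : μ.map (ε t) ≪ volume := by
    rw [(hE.identDistrib t).map_eq, hf]
    exact withDensity_absolutelyContinuous _ _
  refine Measure.AbsolutelyContinuous.mk fun N hN hN0 => ?_
  have hm : Measurable fun q : α × ℝ => a q.1 + b q.1 * q.2 := by fun_prop
  have h1 : μ.map Z = ((μ.map W).prod (μ.map (ε t))).map fun q : α × ℝ => a q.1 + b q.1 * q.2 := by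
    rw [← (indepFun_iff_map_prod_eq_prod_map_map hW.aemeasurable
      (hE.measurable t).aemeasurable).1 hind, Measure.map_map hm (hW.prodMk (hE.measurable t))]
    exact Measure.map_congr h
  have : IsProbabilityMeasure (μ.map (ε t)) :=
    Measure.isProbabilityMeasure_map (hE.measurable t).aemeasurable
  rw [h1, Measure.map_apply hm hN, Measure.prod_apply (hm hN)]
  -- For fixed past `w`, the slice is the preimage of a null set under an affine bijection of the
  -- line, hence null.
  refine lintegral_eq_zero_of_ae_eq_zero (ae_of_all _ fun w => hac ?_)
  have h2 : Prod.mk w ⁻¹' ((fun q : α × ℝ => a q.1 + b q.1 * q.2) ⁻¹' N) =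
      (fun z => b w * z) ⁻¹' ((fun z => a w + z) ⁻¹' N) := rfl
  rw [h2, Real.volume_preimage_mul_left (hb0 w), measure_preimage_add, hN0, mul_zero]

/-! ### Frozen and time-varying autoregressions -/

variable {d : ℕ} {m σ : ℝ → (Fin d → ℝ) → ℝ} {mUp σLow σUp K₁ δ : ℝ}

theorem exists_contractionConst [IsProbabilityMeasure μ] (hd : 1 ≤ d) (hM : CondM m mUp K₁ δ)
    (hS : CondSigma σ σLow σUp K₁ δ) (hE : CondE μ ε) (hδ : DeltaBound μ ε m σ mUp σLow K₁ δ) :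
    ∃ Δ δ' L : ℝ, ContractionConst m σ δ Δ δ' L ∧
      μ.real {ω | |ε 0 ω| ≤ (K₁ + mUp) / σLow} *
        Real.log ((1 + Δ) ^ d * (1 + ∫ ω, |ε 0 ω| ∂μ) ^ d) +
      (1 - μ.real {ω | |ε 0 ω| ≤ (K₁ + mUp) / σLow}) *
        Real.log (δ' * slopeConst d * (1 + ∫ ω, |ε 0 ω| ∂μ) ^ d) < 0 := by
  obtain ⟨Δ, κ, hΔm, hΔσ, hκ, hκ1, hδ⟩ := hδ
  obtain ⟨L₁, hL₁⟩ := hM.lipschitz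
  obtain ⟨L₂, hL₂⟩ := hS.lipschitz
  have hp : μ.real {ω | |ε 0 ω| ≤ (K₁ + mUp) / σLow} < κ := by
    -- The event that the minimum is small contains `|ε (-1)| ≤ K₂`, which has the same probability
    -- as `|ε 0| ≤ K₂`.
    refine lt_of_le_of_lt ?_ hκ
    have h1 : μ.real {ω | |ε 0 ω| ≤ (K₁ + mUp) / σLow} =
        μ.real {ω | |ε (-1) ω| ≤ (K₁ + mUp) / σLow} := by
      have hms : MeasurableSet {x : ℝ | |x| ≤ (K₁ + mUp) / σLow} :=
        measurableSet_le measurable_norm measurable_const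
      have := (hE.identDistrib (-1)).measure_mem_eq hms
      exact congrArg ENNReal.toReal this.symm
    rw [h1]
    refine measureReal_mono fun ω hω => ?_
    exact ⟨1, Finset.mem_Icc.2 ⟨le_rfl, hd⟩, by simpa using hω⟩
  obtain ⟨δ', h1, h2, h3, h4, h5⟩ := exists_slope_log_neg hd
    (integral_nonneg fun ω => abs_nonneg (ε 0 ω)) ((abs_nonneg _).trans (hΔm ⟨0, hd⟩ 0 0)) hp
    measureReal_nonneg hκ1 hδ
  refine ⟨Δ, δ', max L₁ L₂, ⟨hd, hΔm, hΔσ, fun u u' y => (hL₁ u u' y).trans ?_,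
    fun u u' y => (hL₂ u u' y).trans ?_, h1, h2, h4, h3⟩, h5⟩
  · gcongr; exact le_max_left _ _
  · gcongr; exact le_max_right _ _

/-- An autoregressive equation read backwards from time `t`. -/
theorem lags_sub {Ω' : Type*} (Z : ℤ → Ω' → ℝ) (t : ℤ) (i : ℕ) (ω : Ω') :
    lags d Z (t - i) ω = fun j : Fin d => Z (t - ((i + 1 + j : ℕ) : ℤ)) ω := by
  ext j
  simp only [lags]
  congr 1
  push_cast
  ring

/-- The summand `1` inside `V` makes the variable positive; the last `1` in the constant makes the
moment inequality strict. Subadditivity of the power `ρ ≤ 1` does the rest. -/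
theorem momentBound_of_lintegral_le [IsProbabilityMeasure μ] {V : Ω → ENNReal} {ρ β : ℝ}
    {C : ENNReal} (hV : Measurable V) (hρ : 0 < ρ) (hρ1 : ρ ≤ 1) (hβ : 0 ≤ β) (hC : C ≠ ⊤)
    (h : ∫⁻ ω, V ω ^ ρ ∂μ ≤ C) :
    MomentBound μ ρ (1 + β ^ ρ * C.toReal + 1) fun ω => 1 + β * (V ω).toReal := by
  have hVm : Measurable fun ω => (V ω).toReal := hV.ennreal_toReal
  have hfin : ∫⁻ ω, V ω ^ ρ ∂μ ≠ ⊤ := (h.trans_lt hC.lt_top).ne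
  have hVi : Integrable (fun ω => (V ω).toReal ^ ρ) μ := by
    refine (integrable_toReal_of_lintegral_ne_top (hV.pow_const ρ).aemeasurable hfin).congr
      (ae_of_all _ fun ω => ?_)
    simp [ENNReal.toReal_rpow]
  have hVC : ∫ ω, (V ω).toReal ^ ρ ∂μ ≤ C.toReal := by
    have : ∫ ω, (V ω).toReal ^ ρ ∂μ = (∫⁻ ω, V ω ^ ρ ∂μ).toReal := by
      rw [← integral_toReal (hV.pow_const ρ).aemeasurable (ae_lt_top (hV.pow_const ρ) hfin)]
      simp_rw [ENNReal.toReal_rpow]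
    rw [this]
    exact ENNReal.toReal_mono hC h
  have hle : ∀ ω, (1 + β * (V ω).toReal) ^ ρ ≤ 1 + β ^ ρ * (V ω).toReal ^ ρ := fun ω => by
    have hv : 0 ≤ (V ω).toReal := ENNReal.toReal_nonneg
    have := Real.rpow_add_le_add_rpow zero_le_one (mul_nonneg hβ hv) hρ.le hρ1
    rwa [Real.one_rpow, Real.mul_rpow hβ hv] at this
  have hpos : ∀ ω, 0 < 1 + β * (V ω).toReal := fun ω => by
    have hv : 0 ≤ (V ω).toReal := ENNReal.toReal_nonneg
    positivity
  have hdom : Integrable (fun ω => 1 + β ^ ρ * (V ω).toReal ^ ρ) μ :=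
    (integrable_const _).add (hVi.const_mul _)
  have hmeas : Measurable fun ω => 1 + β * (V ω).toReal :=
    measurable_const.add (measurable_const.mul hVm)
  have hint : Integrable (fun ω => (1 + β * (V ω).toReal) ^ ρ) μ :=
    hdom.mono' (hmeas.pow_const ρ).aestronglyMeasurable (ae_of_all _ fun ω => by
      rw [Real.norm_of_nonneg (Real.rpow_nonneg (hpos ω).le _)]
      exact hle ω)
  refine ⟨hmeas, hpos, hint, ?_⟩
  have h1 := integral_mono hint hdom hle
  rw [integral_add (integrable_const _) (hVi.const_mul _), integral_const_mul] at h1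
  have h2 : β ^ ρ * ∫ ω, (V ω).toReal ^ ρ ∂μ ≤ β ^ ρ * C.toReal := by gcongr
  simp only [integral_const, probReal_univ, smul_eq_mul, one_mul] at h1
  linarith

theorem ae_ne_top_of_lintegral_rpow_le {V : Ω → ENNReal} {ρ : ℝ} {C : ENNReal}
    (hV : Measurable V) (hρ : 0 < ρ) (hC : C ≠ ⊤) (h : ∫⁻ ω, V ω ^ ρ ∂μ ≤ C) :
    ∀ᵐ ω ∂μ, V ω ≠ ⊤ := by
  filter_upwards [ae_lt_top (hV.pow_const ρ) (h.trans_lt hC.lt_top).ne] with ω hω hV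
  simp [hV, hρ] at hω

theorem isFrozenNAR_stationarySolution {Δ δ' L : ℝ} (h : ContractionConst m σ δ Δ δ' L)
    (hM : CondM m mUp K₁ δ) (hS : CondSigma σ σLow σUp K₁ δ) (hE : CondE μ ε)
    (hfin : ∀ t, ∀ᵐ ω ∂μ, h.series ((K₁ + mUp) / σLow) (pastNoise ε t ω) ≠ ⊤) (u : ℝ) :
    IsFrozenNAR μ m σ ε u fun t ω => stationarySolution m σ u (pastNoise ε t ω) := by
  intro t
  refine ⟨(measurable_stationarySolution (hM.slopes.1 u).continuous
    (hS.slopes.1 u).continuous).comp (hE.measurable_pastNoise t), ?_⟩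
  filter_upwards [ae_all_iff.2 hfin] with ω hω
  have hshift : ∀ i : ℕ, (fun k => pastNoise ε t ω (k + i)) = pastNoise ε (t - i) ω := fun i => by
    ext k
    simp only [pastNoise]
    congr 1
    push_cast
    ring
  have h1 := h.stationarySolution_eq hM hS (e := pastNoise ε t ω)
    (fun i => by rw [hshift]; exact hω _) u
  have h2 : lags d (fun t ω => stationarySolution m σ u (pastNoise ε t ω)) t ω =
      fun j : Fin d => stationarySolution m σ u fun k => pastNoise ε t ω (k + (1 + j)) := by
    ext j
    rw [hshift, lags]
    congr 2
    push_cast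
    ring
  have h3 : pastNoise ε t ω 0 = ε t ω := by simp [pastNoise]
  rw [h2, ← h3]
  exact h1

/-- The lag vector is a functional of the noise up to `t - 1`, hence independent of `ε t`, and `σ`
is bounded away from zero. -/
theorem hasPDF_stationarySolution [IsProbabilityMeasure μ] {u : ℝ} (hM : CondM m mUp K₁ δ)
    (hS : CondSigma σ σLow σUp K₁ δ) (hE : CondE μ ε)
    (hY : IsFrozenNAR μ m σ ε u fun t ω => stationarySolution m σ u (pastNoise ε t ω)) (t : ℤ) :
    HasPDF (fun ω => stationarySolution m σ u (pastNoise ε t ω)) μ volume := by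
  have hF := measurable_stationarySolution (hM.slopes.1 u).continuous (hS.slopes.1 u).continuous
  have hΦ : Measurable fun (e : ℕ → ℝ) (j : Fin d) =>
      stationarySolution m σ u fun k => e (k + j) :=
    measurable_pi_iff.2 fun j => hF.comp (measurable_pi_iff.2 fun k => measurable_pi_apply _)
  have hlags : lags d (fun t ω => stationarySolution m σ u (pastNoise ε t ω)) t =
      (fun (e : ℕ → ℝ) (j : Fin d) => stationarySolution m σ u fun k => e (k + j)) ∘
        pastNoise ε (t - 1) := by
    ext ω j
    simp only [lags, Function.comp_apply]
    congr 1
    ext k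
    simp only [pastNoise]
    congr 1
    push_cast
    ring
  refine hE.hasPDF (t := t) (hY t).1 (hΦ.comp (hE.measurable_pastNoise (t - 1)))
    (hM.slopes.1 u).continuous.measurable (hS.slopes.1 u).continuous.measurable
    (fun w => (hS.low_pos.trans_le (hS.bounded u w).1).ne')
    ((hE.indepFun_past t).comp hΦ measurable_id) ?_
  have := (hY t).2
  rwa [hlags] at this

theorem abs_tvNAR_sub_frozenNAR_le {Δ δ' L : ℝ} (h : ContractionConst m σ δ Δ δ' L)
    (hM : CondM m mUp K₁ δ) (hS : CondSigma σ σLow σUp K₁ δ)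
    (hfin : ∀ t, ∀ᵐ ω ∂μ, h.series ((K₁ + mUp) / σLow) (pastNoise ε t ω) ≠ ⊤)
    {X : ℕ → ℤ → Ω → ℝ} (hX : IsTvNAR μ m σ ε X) {u : ℝ} {Y : ℤ → Ω → ℝ}
    (hY : IsFrozenNAR μ m σ ε u Y) {T : ℕ} (hT : 1 ≤ T) (t : ℤ) :
    ∀ᵐ ω ∂μ, |X T t ω - Y t ω| ≤ (|(t : ℝ) / T - u| + 1 / T) *
      (1 + L * ((((1 + Δ) ^ d + 1) * d) * d) *
        (h.series ((K₁ + mUp) / σLow) (pastNoise ε t ω)).toReal) := by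
  filter_upwards [hfin t, ae_all_iff.2 fun t => (hX T hT t).2, ae_all_iff.2 fun t => (hY t).2]
    with ω hω hXω hYω
  have hL := h.lipschitz_nonneg
  have hT0 : (0 : ℝ) < T := by exact_mod_cast hT
  set c := |(t : ℝ) / T - u| + 1 / T with hc
  have hc0 : 0 ≤ c := by positivity
  have key := h.abs_sub_le hM hS hω (mul_nonneg hL hc0) (u := u)
    (x := fun i => X T (t - i) ω) (y := fun i => Y (t - i) ω)
    (s := fun i => ((t - (i : ℤ) : ℤ) : ℝ) / T)
    (fun i => by
      have := hXω (t - i)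
      rwa [lags_sub] at this)
    (fun i => by
      have := hYω (t - i)
      rwa [lags_sub] at this)
    (fun i => by
      rw [mul_assoc]
      refine mul_le_mul_of_nonneg_left ?_ hL
      -- Going `i` steps back moves rescaled time by `i / T`, so the distance to `u` is at most `(i
      -- + 1)` times `|t / T - u| + 1 / T`.
      have h1 : ((t - (i : ℤ) : ℤ) : ℝ) / T - u = ((t : ℝ) / T - u) - i * (1 / T) := by
        push_cast; ring
      rw [h1]
      refine (abs_sub _ _).trans ?_
      rw [abs_of_nonneg (show (0 : ℝ) ≤ i * (1 / T) by positivity), hc]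
      have h2 : (0 : ℝ) ≤ |(t : ℝ) / T - u| * i := by positivity
      have h3 : (0 : ℝ) < 1 / T := by positivity
      nlinarith)
  simp only [Nat.cast_zero, sub_zero] at key
  calc _ ≤ _ := key
    _ ≤ c + L * c * ((((1 + Δ) ^ d + 1) * d) * d) *
        (h.series ((K₁ + mUp) / σLow) (pastNoise ε t ω)).toReal := le_add_of_nonneg_left hc0
    _ = _ := by ring

end

end TvNAR

end

theorem theorem3p2 {Ω : Type*} [MeasurableSpace Ω] (μ : Measure Ω) [IsProbabilityMeasure μ]
    (d : ℕ) (hd : 1 ≤ d) (m σ : ℝ → (Fin d → ℝ) → ℝ) (ε : ℤ → Ω → ℝ)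
    (mUp σLow σUp K₁ δ : ℝ)
    (hm_const : TvNAR.ConstOutsideUnit m) (hσ_const : TvNAR.ConstOutsideUnit σ)
    (hM : TvNAR.CondM m mUp K₁ δ) (hS : TvNAR.CondSigma σ σLow σUp K₁ δ)
    (hE : TvNAR.CondE μ ε) (hδ : TvNAR.DeltaBound μ ε m σ mUp σLow K₁ δ)
    (X : ℕ → ℤ → Ω → ℝ) (hX : TvNAR.IsTvNAR μ m σ ε X) :
    (∀ Y : ℝ → ℤ → Ω → ℝ, (∀ u, TvNAR.IsFrozenNAR μ m σ ε u (Y u)) →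
      ∃ (U : ℝ → ℕ → ℤ → Ω → ℝ) (ρ C : ℝ), 0 < ρ ∧
        ∀ (u : ℝ) (T : ℕ) (t : ℤ), 1 ≤ T →
          TvNAR.MomentBound μ ρ C (U u T t) ∧
          ∀ᵐ ω ∂μ, |X T t ω - Y u t ω| ≤ (|(t : ℝ) / T - u| + 1 / T) * U u T t ω) ∧
    TvNAR.IsLocallyStationary μ X := by
  obtain ⟨Δ, δ', L, h, hlog⟩ := TvNAR.exists_contractionConst hd hM hS hE hδ
  obtain ⟨ρ, hρ, hρ1, C, hC, hmom⟩ :=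
    TvNAR.exists_blockSeries_moment hd h.large_pos h.small_pos hE.integrable hlog
  have hmom' : ∀ t, ∫⁻ ω, h.series ((K₁ + mUp) / σLow) (TvNAR.pastNoise ε t ω) ^ ρ ∂μ ≤ C :=
    fun t => hmom (fun k => ε (t - k)) (fun k => hE.measurable _) (hE.iIndepFun_past t)
      fun k => hE.identDistrib _
  have hV : ∀ t, Measurable fun ω => h.series ((K₁ + mUp) / σLow) (TvNAR.pastNoise ε t ω) :=
    fun t => (TvNAR.measurable_blockSeries _ _ _ _).comp (hE.measurable_pastNoise t)
  have hfin : ∀ t, ∀ᵐ ω ∂μ, h.series ((K₁ + mUp) / σLow) (TvNAR.pastNoise ε t ω) ≠ ⊤ :=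
    fun t => TvNAR.ae_ne_top_of_lintegral_rpow_le (hV t) hρ hC (hmom' t)
  have hβ : 0 ≤ L * ((((1 + Δ) ^ d + 1) * d) * d) := by
    have := h.large_pos
    have := h.lipschitz_nonneg
    positivity
  obtain ⟨C', hbound⟩ : ∃ C', ∀ t, TvNAR.MomentBound μ ρ C' fun ω =>
      1 + L * ((((1 + Δ) ^ d + 1) * d) * d) *
        (h.series ((K₁ + mUp) / σLow) (TvNAR.pastNoise ε t ω)).toReal :=
    ⟨_, fun t => TvNAR.momentBound_of_lintegral_le (hV t) hρ hρ1 hβ hC (hmom' t)⟩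
  refine ⟨fun Y hY => ⟨fun _ _ t ω => 1 + L * ((((1 + Δ) ^ d + 1) * d) * d) *
      (h.series ((K₁ + mUp) / σLow) (TvNAR.pastNoise ε t ω)).toReal, ρ, C', hρ,
      fun u T t hT => ⟨hbound t, TvNAR.abs_tvNAR_sub_frozenNAR_le h hM hS hfin hX (hY u) hT t⟩⟩,
    fun u t ω => TvNAR.stationarySolution m σ u (TvNAR.pastNoise ε t ω),
    fun _ _ t ω => 1 + L * ((((1 + Δ) ^ d + 1) * d) * d) *
      (h.series ((K₁ + mUp) / σLow) (TvNAR.pastNoise ε t ω)).toReal, ρ, C', hρ, fun u _ => ?_⟩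
  have hY := TvNAR.isFrozenNAR_stationarySolution h hM hS hE hfin u
  exact ⟨hE.isStrictlyStationary (TvNAR.measurable_stationarySolution
      (hM.slopes.1 u).continuous (hS.slopes.1 u).continuous),
    TvNAR.hasPDF_stationarySolution hM hS hE hY,
    fun T t h1 hT => ⟨hbound t,
      TvNAR.abs_tvNAR_sub_frozenNAR_le h hM hS hfin hX hY (by exact_mod_cast h1.trans hT) t⟩⟩
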